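/- **Setting.** A Wiener moustache $\eta\subset\mathbb C$ is the union of the ranges of two planar paths $R^{(j)}_te^{i\Theta^{(j)}_t}$, $t\ge 0$, $j=1,2$, with $$dR_t=\Big(\frac1{R_t\ln R_t}+\frac1{2R_t}\Big)dt+dW^{(1)}_t,\qquad d\Theta_t=\frac1{R_t}\,dW^{(2)}_t,\qquad (R_0,\Theta_0)=(1,U),\quad R_t>1\text{ for }t>0,$$ where $U$ is uniform on $[0,2\pi]$, common to $j=1,2$, and the standard Brownian motions $W^{(1)},W^{(2)}$ for $j=1,2$ are independent of each other and of $U$. Let $(x_k,u_k)_{k}$ be the points of a Poisson point process of rate $1$ on $\mathbb R\times\mathbb R_+$ and let $(\eta_k)_k$ be an independent sequence of i.i.d. Wiener moustaches. For $\alpha>0$ let $$\mathrm{BRI}(\alpha)=\bigcup_{k:\;u_k\le 2\alpha,\;e^{x_k}\ge 1}e^{x_k}\eta_k,\qquad \Phi_0(\alpha)=\mathrm{dist}\big(0,\mathrm{BRI}(\alpha)\big),$$ simultaneously for all $\alpha>0$, and let $$Y(\beta)=\beta+\ln\ln\Phi_0(e^\beta)+\ln 2,\qquad \beta\in\mathbb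 R .$$ **Theorem.** Almost surely $\Phi_0(\alpha)>1$ for all $\alpha>0$, so that $Y$ is well defined, and $Y$ is a stationary, time-homogeneous Markov process (with respect to its natural filtration) with unit drift in the positive direction, jump rate $e^y$, and jumps distributed as the negative of an $\mathrm{Exp}(1)$ random variable. More precisely: 1. Almost surely $Y$ has càdlàg paths with finitely many jumps in each bounded interval, and it solves $$dY(\beta)=d\beta-\mathcal E_\beta\,dN(\beta),$$ where $N$ is a point process with stochastic intensity $\exp Y(\beta)$ and marks $\mathcal E_\beta$ with $\mathrm{Exp}(1)$-distribution, with respect to the natural filtration of $Y$. That is, the marked point process of the jumps of $Y$ has finite mean number of points on bounded time intervals and compensator $e^{Y(\beta)}d\beta\otimes e^{-u}\mathbf 1_{u>0}\,du$. 2. There is a semigroup $(P_t)_{t\ge0}$ of Markov transition kernels of $Y$ whose infinitesimal generator is given, for every $C^1$ function $f:\mathbb R\to\mathbb R$ with $\int_0^\infty|f(y-u)|e^{-u}du<\infty$ for all $y$, by $$\lim_{t\downarrow0}\frac{P_tf(y)-f(y)}t=\mathcal Lf(y)= f'(y)+e^y\int_0^{\infty}\big[f(y-u)-f(y)\big]e^{-u}\,du\qquad\text{for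 every }y\in\mathbb R,$$ where $P_tf(y)$ is a convergent integral. 3. The unique invariant probability measure of $(P_t)$ is the law of the negative of a standard Gumbel variable (a variable with distribution function $x\mapsto\exp(-e^{-x})$); it has density $\exp\{y-e^y\}$ on $\mathbb R$. It is the law of $Y(\beta)$ for every $\beta$. -/

import Mathlib

open MeasureTheory ProbabilityTheory Set Filter Topology
open scoped NNReal ENNReal

noncomputable section

namespace BrownianInterlacement

variable {Ω : Type*} [MeasurableSpace Ω]

/-! ### Poisson point processes -/

/-- Number (with multiplicity) of the points `X k ω`, `k ∈ ℕ`, lying in `A`. -/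
def pointCount {E : Type*} (X : ℕ → Ω → E) (A : Set E) (ω : Ω) : ℝ≥0∞ :=
  ∑' k, A.indicator 1 (X k ω)

/-- The random points `X 0, X 1, …` form a Poisson point process with intensity measure `ν`
(of infinite total mass, so that the points can be listed as a sequence). -/
structure IsPoissonPointProcess {E : Type*} [MeasurableSpace E] (X : ℕ → Ω → E)
    (ν : Measure E) (P : Measure Ω) : Prop where
  measurable : ∀ k, Measurable (X k)
  hasLaw_count : ∀ A, MeasurableSet A → ν A ≠ ∞ →
    HasLaw (pointCount X A) ((poissonMeasure (ν A).toNNReal).map (Nat.cast : ℕ → ℝ≥0∞)) P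
  indep_count : ∀ (n : ℕ) (A : Fin n → Set E), (∀ i, MeasurableSet (A i)) →
    Pairwise (fun i j => Disjoint (A i) (A j)) → iIndepFun (fun i => pointCount X (A i)) P

/-! ### The Wiener moustache -/

/-- Drift of the radial part of planar Brownian motion conditioned to stay outside the
unit disk. -/
def radialDrift (r : ℝ) : ℝ := 1 / (r * Real.log r) + 1 / (2 * r)

/-- Riemann sum, along the `n`-th dyadic subdivision of `[0, t]`, of the Itô integral
`∫₀ᵗ H dW`. -/
def itoSum (H W : ℝ≥0 → Ω → ℝ) (t : ℝ≥0) (n : ℕ) (ω : Ω) : ℝ :=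
  ∑ i ∈ Finset.range (2 ^ n),
    H (i * t / 2 ^ n) ω * (W ((i + 1) * t / 2 ^ n) ω - W (i * t / 2 ^ n) ω)

/-- A Wiener moustache. Each of its two arms `j` is, in polar coordinates, a solution
`(radius j, arg j)` of
`dR = (1 / (R ln R) + 1 / (2R)) dt + dW¹`, `dΘ = (1 / R) dW²`
with `W¹ = noise j 0`, `W² = noise j 1`. Both arms start at `(1, angle)`, with a uniform angle,
and they are driven by independent Brownian motions. -/
structure WienerMoustache (P : Measure Ω) where
  angle : Ω → ℝ
  noise : Fin 2 → Fin 2 → ℝ≥0 → Ω → ℝ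
  radius : Fin 2 → ℝ≥0 → Ω → ℝ
  arg : Fin 2 → ℝ≥0 → Ω → ℝ
  measurable_angle : Measurable angle
  measurable_radius : ∀ j t, Measurable (radius j t)
  measurable_arg : ∀ j t, Measurable (arg j t)
  angle_uniform : pdf.IsUniform angle (Icc 0 (2 * Real.pi)) P
  noise_brownian : ∀ j i, IsBrownianReal (noise j i) P
  noise_indep : iIndepFun (fun (q : Fin 2 × Fin 2) ω t => noise q.1 q.2 t ω) P
  angle_indep : IndepFun angle (fun ω j i t => noise j i t ω) P
  radius_continuous : ∀ j, ∀ᵐ ω ∂P, Continuous (fun t => radius j t ω)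
  radius_zero : ∀ j, ∀ᵐ ω ∂P, radius j 0 ω = 1
  one_lt_radius : ∀ j, ∀ᵐ ω ∂P, ∀ t, 0 < t → 1 < radius j t ω
  radius_sde : ∀ j, ∀ᵐ ω ∂P, ∀ t : ℝ≥0,
    IntervalIntegrable (fun s => radialDrift (radius j s.toNNReal ω)) volume 0 t ∧
    radius j t ω = 1 + (∫ s in (0 : ℝ)..t, radialDrift (radius j s.toNNReal ω)) + noise j 0 t ω
  arg_continuous : ∀ j, ∀ᵐ ω ∂P, Continuous (fun t => arg j t ω)
  arg_zero : ∀ j, ∀ᵐ ω ∂P, arg j 0 ω = angle ω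
  arg_sde : ∀ j, ∀ t : ℝ≥0,
    TendstoInMeasure P (itoSum (fun s ω => (radius j s ω)⁻¹) (noise j 1) t) atTop
      (fun ω => arg j t ω - arg j 0 ω)

/-- The moustache as a random subset of the plane: the union of the ranges of its arms. -/
def WienerMoustache.range {P : Measure Ω} (η : WienerMoustache P) (ω : Ω) : Set ℂ :=
  {z | ∃ (j : Fin 2) (t : ℝ≥0),
    z = (η.radius j t ω : ℂ) * Complex.exp (Complex.I * (η.arg j t ω : ℂ))}

/-! ### Two-dimensional Brownian random interlacements, simultaneously for all levels -/

/-- The randomness of the interlacements: a Poisson point process of rate `1` on `ℝ × ℝ₊` and an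
independent sequence of i.i.d. Wiener moustaches, one attached to each point. (The moustaches are
functions of their driving noises, so independence is expressed through the latter.) -/
structure Model (P : Measure Ω) where
  point : ℕ → Ω → ℝ × ℝ
  moustache : ℕ → WienerMoustache P
  poisson : IsPoissonPointProcess point
    ((volume : Measure ℝ).prod ((volume : Measure ℝ).restrict (Ici 0))) P
  moustache_indep : iIndepFun
    (fun k ω => ((moustache k).angle ω, fun j i t => (moustache k).noise j i t ω)) P
  point_indep : IndepFun (fun ω k => point k ω)
    (fun ω k => ((moustache k).angle ω, fun j i t => (moustache k).noise j i t ω)) P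

namespace Model

variable {P : Measure Ω} (M : Model P)

/-- `BRI(α; b)`: the moustaches attached to the points `(x, u)` with `u ≤ 2α` and `exp x ≥ b`,
scaled by the factor `exp x`. -/
def bri (α b : ℝ) (ω : Ω) : Set ℂ :=
  ⋃ k ∈ {k | (M.point k ω).2 ≤ 2 * α ∧ b ≤ Real.exp (M.point k ω).1},
    (fun z => (Real.exp (M.point k ω).1 : ℂ) * z) '' (M.moustache k).range ω

/-- `Φ_x(α)`, the distance from `x` to `BRI(α) = BRI(α; 1)`. -/
def Φ (x : ℂ) (α : ℝ) (ω : Ω) : ℝ := Metric.infDist x (M.bri α 1 ω)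

/-- `Y(β) = β + ln ln Φ₀(e^β) + ln 2`. -/
def Y (β : ℝ) (ω : Ω) : ℝ :=
  β + Real.log (Real.log (M.Φ 0 (Real.exp β) ω)) + Real.log 2

end Model

/-! ### Real-valued processes indexed by the whole real line -/

/-- The law of the whole path is invariant under time shifts. -/
def IsStationary (X : ℝ → Ω → ℝ) (P : Measure Ω) : Prop :=
  ∀ h : ℝ, IdentDistrib (fun ω t => X (t + h) ω) (fun ω t => X t ω) P P

/-- The event that the past `(X s)_{s ≤ t}` of the process lies in `A`. As `A` varies over the
measurable sets, these are the events of the σ-algebra generated by `X s`, `s ≤ t`. -/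
def pastEvent (X : ℝ → Ω → ℝ) (t : ℝ) (A : Set (Iic t → ℝ)) : Set Ω :=
  {ω | (fun s : Iic t => X s ω) ∈ A}

/-- A semigroup of Markov transition kernels on `ℝ`. -/
structure IsMarkovSemigroup (κ : ℝ≥0 → Kernel ℝ ℝ) : Prop where
  markov : ∀ t, IsMarkovKernel (κ t)
  zero : κ 0 = Kernel.id
  add : ∀ s t, κ (s + t) = κ t ∘ₖ κ s

/-- `X` is a (time-homogeneous) Markov process with transition kernels `κ`, with respect to its
natural filtration: `P[X (s + t) ∈ B | X r, r ≤ s] = κ t (X s) B`. -/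
def IsMarkovProcess (X : ℝ → Ω → ℝ) (κ : ℝ≥0 → Kernel ℝ ℝ) (P : Measure Ω) : Prop :=
  ∀ (s : ℝ) (t : ℝ≥0) (A : Set (Iic s → ℝ)) (B : Set ℝ), MeasurableSet A → MeasurableSet B →
    P (pastEvent X s A ∩ {ω | X (s + t) ω ∈ B}) =
      ∫⁻ ω in pastEvent X s A, κ t (X s ω) B ∂P

/-- `ℒ f (y) = f'(y) + e^y ∫₀^∞ [f(y - u) - f(y)] e^{-u} du`. -/
def generator (f : ℝ → ℝ) (y : ℝ) : ℝ :=
  deriv f y + Real.exp y * ∫ u in Ioi (0 : ℝ), (f (y - u) - f y) * Real.exp (-u)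

/-- The measure with density `exp (y - e^y)`. -/
def negGumbel : Measure ℝ :=
  volume.withDensity fun y => ENNReal.ofReal (Real.exp (y - Real.exp y))

/-- Size `X(t-) - X(t)` of the downward jump of `X` at time `t`. -/
def jumpSize (X : ℝ → Ω → ℝ) (ω : Ω) (t : ℝ) : ℝ :=
  Function.leftLim (fun s => X s ω) t - X t ω

/-- Jump times of `X` in `(s, t]`. -/
def jumpTimes (X : ℝ → Ω → ℝ) (ω : Ω) (s t : ℝ) : Set ℝ :=
  {r ∈ Ioc s t | jumpSize X ω r ≠ 0}

/-- Number of the jumps of `X` in `(s, t]` whose size lies in `A`. -/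
def jumpCount (X : ℝ → Ω → ℝ) (s t : ℝ) (A : Set ℝ) (ω : Ω) : ℝ≥0∞ :=
  ({r ∈ jumpTimes X ω s t | jumpSize X ω r ∈ A}.encard : ℝ≥0∞)

/-- `X` has càdlàg paths and solves `dX(t) = dt - ℰ_t dN(t)`, where `N` is a point process with
stochastic intensity `rate (X t)` and marks `ℰ_t` of law `m`, with respect to the natural
filtration of `X`. The points of `N` and their marks are the jump times and jump sizes of `X`;
the `intensity` clause says that for each mark set `A` the process
`N((s, t] × A) - m(A) ∫ₛᵗ rate (X r) dr`, `t ≥ s`, is a martingale. -/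
structure SolvesJumpSDE (X : ℝ → Ω → ℝ) (rate : ℝ → ℝ) (m : Measure ℝ) (P : Measure Ω) :
    Prop where
  cadlag : ∀ᵐ ω ∂P, ∀ t, ContinuousWithinAt (fun s => X s ω) (Ici t) t ∧
    ∃ l, Tendsto (fun s => X s ω) (𝓝[<] t) (𝓝 l)
  equation : ∀ᵐ ω ∂P, ∀ s t, s ≤ t → (jumpTimes X ω s t).Finite ∧
    X t ω - X s ω = (t - s) - ∑ᶠ r ∈ jumpTimes X ω s t, jumpSize X ω r
  aemeasurable_jumpCount : ∀ s t A, MeasurableSet A → AEMeasurable (jumpCount X s t A) P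
  finite_intensity : ∀ s t,
    ∫⁻ ω, (∫⁻ r in Ioc s t, ENNReal.ofReal (rate (X r ω))) ∂P < ∞
  intensity : ∀ s t, s ≤ t →
    ∀ (F : Set (Iic s → ℝ)) (A : Set ℝ), MeasurableSet F → MeasurableSet A →
      ∫⁻ ω in pastEvent X s F, jumpCount X s t A ω ∂P =
        m A * ∫⁻ ω in pastEvent X s F,
          (∫⁻ r in Ioc s t, ENNReal.ofReal (rate (X r ω))) ∂P

end BrownianInterlacement

end

/-! ### The explicit transition semigroup, its invariant law and its generator. -/

noncomputable section

namespace BrownianInterlacement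

/-! ### The exponential distribution and the negative Gumbel distribution -/

/-! Every arm starts on the unit circle and stays outside it, so the point of the interlacement
nearest to the origin is the start of a moustache. Hence `ln Φ₀(α)` is the smallest abscissa `x ≥ 0`
among the Poisson points with `u ≤ 2α` (`Φ_eq`), and `Y(β) > y` says that the box `[0, e^{y-β}/2] ×
[0, 2e^β]`, of area `e^y`, contains no point (`lt_Y_iff`). The shapes of the moustaches then play no
further role: the events that determine the law of `Y` are void events of a planar Poisson process,
with probability `exp (-area of a union of boxes)`. `IsVoidProcess` records this, together with the
paths being drifts with isolated jumps; everything else is derived from it.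

Stationarity: `(x, u) ↦ (e^h x, e^{-h} u)` preserves area and turns the boxes of time `β` into those
of time `β + h`.

Markov property: the box for `Y(s+t) > z` is the box for `Y(s) > z - t` plus a strip of larger
heights, of area `(1 - e^{-t}) e^z`, disjoint from all boxes of times up to `s`
(`pointRate_voidBox_union`). So, given the past, `Y(s+t) > z` has probability `exp (-(1 - e^{-t})
e^z)` on `Y(s) > z - t`, and `0` elsewhere. This tail formula (`transitionLaw_Ioi`) gives the
semigroup property and the invariant law; uniqueness follows on letting `t → ∞`. The generator comes
from differentiating the explicit law, an atom plus a density.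

Intensity of the jumps: over a short time the drop has law close to `c • Exp(1)`, where `c` is the
step length times `e^Y` to first order (`jumpLaw_le`, `le_jumpLaw`). Drops over a grid count the
jumps once the mesh is fine, their conditional means form a Riemann sum of `e^Y`, and both limits
pass through the expectation by dominated convergence (`IsVoidProcess.intensity`). -/

lemma expMeasure_one_eq : expMeasure 1 =
    ((volume : Measure ℝ).restrict (Ioi 0)).withDensity
      (fun v => ENNReal.ofReal (Real.exp (-v))) := by
  have h : expMeasure 1 = volume.withDensity (exponentialPDF 1) := rfl
  rw [h, ← withDensity_indicator measurableSet_Ioi]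
  refine withDensity_congr_ae ?_
  have h0 : ∀ᵐ v : ℝ, v ≠ 0 := by simp [ae_iff]
  filter_upwards [h0] with v hv
  rcases lt_or_gt_of_ne hv with hv | hv
  · rw [exponentialPDF_of_neg hv, indicator_of_notMem (by simp [hv.le])]
  · rw [exponentialPDF_of_nonneg hv.le, indicator_of_mem (by exact hv)]; simp

instance isProbabilityMeasure_expMeasure_one : IsProbabilityMeasure (expMeasure 1) :=
  isProbabilityMeasure_expMeasure one_pos

lemma integrable_expMeasure_one_iff {f : ℝ → ℝ} :
    Integrable f (expMeasure 1) ↔ IntegrableOn (fun u => f u * Real.exp (-u)) (Ioi 0) := by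
  rw [expMeasure_one_eq, integrable_withDensity_iff (by fun_prop) (by simp)]
  simp [IntegrableOn, ENNReal.toReal_ofReal, Real.exp_nonneg]

lemma integral_expMeasure_one (f : ℝ → ℝ) :
    ∫ u, f u ∂(expMeasure 1) = ∫ u in Ioi (0 : ℝ), f u * Real.exp (-u) := by
  rw [expMeasure_one_eq, integral_withDensity_eq_integral_toReal_smul (by fun_prop) (by simp)]
  simp [ENNReal.toReal_ofReal, Real.exp_nonneg, mul_comm]

lemma hasDerivAt_exp_neg_mul_exp_neg (c v : ℝ) :
    HasDerivAt (fun v => Real.exp (-(c * Real.exp (-v))))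
      (Real.exp (-v) * (c * Real.exp (-(c * Real.exp (-v))))) v := by
  have h : HasDerivAt (fun v => -(c * Real.exp (-v))) (-(c * (Real.exp (-v) * -1))) v :=
    (((hasDerivAt_neg v).exp).const_mul c).neg
  convert! h.exp using 1
  ring

/-- A probability measure on `ℝ` is determined by its tails. -/
lemma ext_of_Ioi {μ ν : Measure ℝ} [IsProbabilityMeasure μ] [IsProbabilityMeasure ν]
    (h : ∀ z, μ (Ioi z) = ν (Ioi z)) : μ = ν := by
  refine ext_of_generate_finite (range Ioi)
    (BorelSpace.measurable_eq.trans (borel_eq_generateFrom_Ioi ℝ)) isPiSystem_Ioi ?_ (by simp)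
  rintro _ ⟨z, rfl⟩
  exact h z

lemma negGumbel_Ioi (z : ℝ) :
    negGumbel (Ioi z) = ENNReal.ofReal (Real.exp (-Real.exp z)) := by
  have hd : ∀ x : ℝ, HasDerivAt (fun y => -Real.exp (-Real.exp y))
      (Real.exp (x - Real.exp x)) x := by
    intro x
    convert! ((Real.hasDerivAt_exp x).neg.exp).neg using 1
    rw [sub_eq_add_neg, Real.exp_add, Pi.neg_apply]; ring
  have ht : Tendsto (fun y => -Real.exp (-Real.exp y)) atTop (𝓝 0) := by
    rw [← neg_zero]
    exact (Real.tendsto_exp_neg_atTop_nhds_zero.comp Real.tendsto_exp_atTop).neg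
  have hfi := integrableOn_Ioi_deriv_of_nonneg' (fun x (_ : x ∈ Ici z) => hd x)
    (fun x _ => (Real.exp_pos _).le) ht
  rw [negGumbel, withDensity_apply _ measurableSet_Ioi,
    ← ofReal_integral_eq_lintegral_ofReal hfi (ae_of_all _ fun x => (Real.exp_pos _).le),
    integral_Ioi_of_hasDerivAt_of_tendsto' (fun x _ => hd x) hfi ht]
  simp

instance isProbabilityMeasure_negGumbel : IsProbabilityMeasure negGumbel := by
  constructor
  have hm : Tendsto (fun n : ℕ => negGumbel (Ioi (-(n : ℝ)))) atTop
      (𝓝 (negGumbel (⋃ n : ℕ, Ioi (-(n : ℝ))))) :=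
    tendsto_measure_iUnion_atTop fun m n hmn => Ioi_subset_Ioi (by simpa using hmn)
  have hu : (⋃ n : ℕ, Ioi (-(n : ℝ))) = univ := by
    refine eq_univ_of_forall fun x => mem_iUnion.2 ?_
    obtain ⟨n, hn⟩ := exists_nat_gt (-x)
    exact ⟨n, by simp only [mem_Ioi]; linarith⟩
  rw [hu] at hm
  refine tendsto_nhds_unique hm ?_
  simp_rw [negGumbel_Ioi]
  rw [← ENNReal.ofReal_one]
  refine ENNReal.tendsto_ofReal ?_
  have h := (Real.tendsto_exp_neg_atTop_nhds_zero.comp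
    (tendsto_natCast_atTop_atTop (R := ℝ))).neg
  simpa [Function.comp_def] using (Real.continuous_exp.tendsto _).comp h

lemma negGumbel_map_neg_Iic (x : ℝ) : (negGumbel.map fun y => -y) (Iic x) =
    ENNReal.ofReal (Real.exp (-Real.exp (-x))) := by
  have : (fun y : ℝ => -y) ⁻¹' Iic x = Ici (-x) := by ext; simp
  have hac : negGumbel ≪ volume := withDensity_absolutelyContinuous _ _
  rw [Measure.map_apply measurable_neg measurableSet_Iic, this, ← negGumbel_Ioi]
  exact measure_congr (hac.ae_le Ioi_ae_eq_Ici.symm)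

/-! ### The transition kernels -/

/-- The mean number of points that appear within time `t` below the level `y`. -/
def jumpIntensity (t : ℝ≥0) (y : ℝ) : ℝ := (Real.exp t - 1) * Real.exp y

lemma jumpIntensity_nonneg (t : ℝ≥0) (y : ℝ) : 0 ≤ jumpIntensity t y :=
  mul_nonneg (by simp) (Real.exp_pos y).le

/-- The (defective) law of the size of the jump during a time interval, when `c` is the mean
number of points. -/
def jumpLaw (c : ℝ) : Measure ℝ :=
  (expMeasure 1).withDensity fun v => ENNReal.ofReal (c * Real.exp (-(c * Real.exp (-v))))

lemma jumpLaw_eq (c : ℝ) (A : Set ℝ) (hA : MeasurableSet A) : jumpLaw c A =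
    ∫⁻ v in A ∩ Ioi 0,
      ENNReal.ofReal (Real.exp (-v) * (c * Real.exp (-(c * Real.exp (-v))))) := by
  rw [jumpLaw, withDensity_apply _ hA, expMeasure_one_eq, restrict_withDensity hA,
    lintegral_withDensity_eq_lintegral_mul _ (by fun_prop) (by fun_prop),
    Measure.restrict_restrict hA]
  refine lintegral_congr fun v => ?_
  rw [Pi.mul_apply, ← ENNReal.ofReal_mul (Real.exp_pos _).le]

/-- If a Poisson number of points of mean `c` is spread uniformly to the left of the current
leftmost point, `exp (-c e^{-v})` is the probability that none lies in the leftmost fraction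
`e^{-v}`; there the new leftmost point would make the drop at least `v`. The density of `jumpLaw` is
the derivative of this function, and `exp (-c)` is the case of no point at all. -/
lemma jumpLaw_Iio {c a : ℝ} (hc : 0 ≤ c) (ha : 0 < a) : jumpLaw c (Iio a) =
    ENNReal.ofReal (Real.exp (-(c * Real.exp (-a))) - Real.exp (-c)) := by
  have hs : Iio a ∩ Ioi 0 = Ioo 0 a := by ext; simp [and_comm]
  have hcont : Continuous fun v => Real.exp (-v) * (c * Real.exp (-(c * Real.exp (-v)))) := by
    fun_prop
  rw [jumpLaw_eq _ _ measurableSet_Iio, hs, setLIntegral_congr Ioo_ae_eq_Ioc,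
    ← ofReal_integral_eq_lintegral_ofReal
      ((hcont.integrableOn_Icc (a := 0) (b := a)).mono_set Ioc_subset_Icc_self)
      (ae_of_all _ fun v => by positivity),
    ← intervalIntegral.integral_of_le ha.le,
    intervalIntegral.integral_eq_sub_of_hasDerivAt
      (fun v _ => hasDerivAt_exp_neg_mul_exp_neg c v) (hcont.intervalIntegrable _ _)]
  simp

lemma jumpLaw_Iio_of_nonpos (c : ℝ) {a : ℝ} (ha : a ≤ 0) : jumpLaw c (Iio a) = 0 := by
  have hs : Iio a ∩ Ioi 0 = ∅ := by
    ext x; simp only [mem_inter_iff, mem_Iio, mem_Ioi, mem_empty_iff_false, iff_false]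
    rintro ⟨h1, h2⟩; linarith
  rw [jumpLaw_eq _ _ measurableSet_Iio, hs]; simp

lemma jumpLaw_univ {c : ℝ} (hc : 0 ≤ c) :
    jumpLaw c univ = ENNReal.ofReal (1 - Real.exp (-c)) := by
  -- The shift by one keeps the endpoint positive at `n = 0`, as `jumpLaw_Iio` requires.
  have hm : Tendsto (fun n : ℕ => jumpLaw c (Iio ((n : ℝ) + 1))) atTop
      (𝓝 (jumpLaw c (⋃ n : ℕ, Iio ((n : ℝ) + 1)))) :=
    tendsto_measure_iUnion_atTop fun m n hmn => Iio_subset_Iio (by simpa using hmn)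
  have hu : (⋃ n : ℕ, Iio ((n : ℝ) + 1)) = univ := by
    refine eq_univ_of_forall fun x => mem_iUnion.2 ?_
    obtain ⟨n, hn⟩ := exists_nat_gt x
    exact ⟨n, by simp only [mem_Iio]; linarith⟩
  rw [hu] at hm
  refine tendsto_nhds_unique hm ?_
  have he : ∀ n : ℕ, jumpLaw c (Iio ((n : ℝ) + 1)) =
      ENNReal.ofReal (Real.exp (-(c * Real.exp (-((n : ℝ) + 1)))) - Real.exp (-c)) :=
    fun n => jumpLaw_Iio hc (by positivity)
  simp_rw [he]
  refine ENNReal.tendsto_ofReal (Tendsto.sub_const ?_ _)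
  have h := ((Real.tendsto_exp_neg_atTop_nhds_zero.comp
    (tendsto_atTop_add_const_right _ 1 (tendsto_natCast_atTop_atTop (R := ℝ)))).const_mul c).neg
  simpa [Function.comp_def] using (Real.continuous_exp.tendsto _).comp h

/-- The law at time `t` of the process started from `y`. -/
def transitionLaw (t : ℝ≥0) (y : ℝ) : Measure ℝ :=
  ENNReal.ofReal (Real.exp (-jumpIntensity t y)) • Measure.dirac (y + t) +
    (jumpLaw (jumpIntensity t y)).map fun v => y + t - v

instance isProbabilityMeasure_transitionLaw (t : ℝ≥0) (y : ℝ) :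
    IsProbabilityMeasure (transitionLaw t y) := by
  constructor
  have hc := jumpIntensity_nonneg t y
  rw [transitionLaw, Measure.add_apply, Measure.map_apply (by fun_prop) MeasurableSet.univ,
    preimage_univ, jumpLaw_univ hc, Measure.smul_apply, measure_univ, smul_eq_mul, mul_one,
    ← ENNReal.ofReal_add (Real.exp_pos _).le (by simp [hc])]
  simp

/-- The atom cancels the term `exp (-c)` of `jumpLaw_Iio`, and `c e^{-(y+t-z)}` no longer depends on
`y`. The starting point thus enters only through the indicator, so integrating a tail against any
law yields a tail of that law times a constant. -/
lemma transitionLaw_Ioi (t : ℝ≥0) (y z : ℝ) : transitionLaw t y (Ioi z) =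
    (Ioi (z - t)).indicator
      (fun _ => ENNReal.ofReal (Real.exp (-((1 - Real.exp (-t)) * Real.exp z)))) y := by
  have hc := jumpIntensity_nonneg t y
  have hp : (fun v => y + t - v) ⁻¹' Ioi z = Iio (y + t - z) := by
    ext v; simp only [mem_preimage, mem_Ioi, mem_Iio]; constructor <;> intro h <;> linarith
  rw [transitionLaw, Measure.add_apply, Measure.map_apply (by fun_prop) measurableSet_Ioi, hp,
    Measure.smul_apply, Measure.dirac_apply' _ measurableSet_Ioi, smul_eq_mul]
  by_cases h : z - t < y
  · have h1 : z < y + t := by linarith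
    have h2 : jumpIntensity t y * Real.exp (-(y + t - z)) =
        (1 - Real.exp (-t)) * Real.exp z := by
      have e1 : Real.exp (-(y + t - z)) = Real.exp (-t) * Real.exp (-y) * Real.exp z := by
        rw [← Real.exp_add, ← Real.exp_add]; congr 1; ring
      have e2 : Real.exp y * Real.exp (-y) = 1 := by rw [← Real.exp_add]; simp
      have e3 : Real.exp t * Real.exp (-t) = 1 := by rw [← Real.exp_add]; simp
      rw [jumpIntensity, e1]
      linear_combination (Real.exp t - 1) * Real.exp (-t) * Real.exp z * e2 + Real.exp z * e3
    have h3 : Real.exp (-(y + t - z)) ≤ 1 := Real.exp_le_one_iff.2 (by linarith)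
    rw [jumpLaw_Iio hc (by linarith), indicator_of_mem (by exact h1),
      indicator_of_mem (by exact h), Pi.one_apply, mul_one,
      ← ENNReal.ofReal_add (Real.exp_pos _).le, h2]
    · congr 1; ring
    · rw [sub_nonneg, Real.exp_le_exp, neg_le_neg_iff]
      exact mul_le_of_le_one_right hc h3
  · rw [jumpLaw_Iio_of_nonpos _ (by linarith), indicator_of_notMem (by simp only [mem_Ioi]; linarith),
      indicator_of_notMem (by exact h)]
    simp

/-- The transition kernels of the process with unit drift, jump rate `exp y` and downward jumps
of law `Exp(1)`. -/
def transitionKernel (t : ℝ≥0) : Kernel ℝ ℝ where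
  toFun := transitionLaw t
  measurable' := by
    refine .measure_of_isPiSystem_of_isProbabilityMeasure
      (BorelSpace.measurable_eq.trans (borel_eq_generateFrom_Ioi ℝ)) isPiSystem_Ioi ?_
    rintro _ ⟨z, rfl⟩
    simp_rw [transitionLaw_Ioi]
    exact measurable_const.indicator measurableSet_Ioi

@[simp] lemma transitionKernel_apply (t : ℝ≥0) (y : ℝ) :
    transitionKernel t y = transitionLaw t y := rfl

instance isMarkovKernel_transitionKernel (t : ℝ≥0) : IsMarkovKernel (transitionKernel t) :=
  ⟨fun y => isProbabilityMeasure_transitionLaw t y⟩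

lemma lintegral_transitionLaw_Ioi (μ : Measure ℝ) (t : ℝ≥0) (z : ℝ) :
    ∫⁻ y, transitionLaw t y (Ioi z) ∂μ =
      ENNReal.ofReal (Real.exp (-((1 - Real.exp (-t)) * Real.exp z))) * μ (Ioi (z - t)) := by
  simp_rw [transitionLaw_Ioi]
  rw [lintegral_indicator_const measurableSet_Ioi]

lemma isMarkovSemigroup_transitionKernel : IsMarkovSemigroup transitionKernel where
  markov := inferInstance
  zero := by
    refine Kernel.ext fun y => ext_of_Ioi fun z => ?_
    rw [transitionKernel_apply, transitionLaw_Ioi, Kernel.id_apply,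
      Measure.dirac_apply' _ measurableSet_Ioi]
    simp [indicator]
  add s t := by
    refine Kernel.ext fun y => ext_of_Ioi fun z => ?_
    rw [Kernel.comp_apply' _ _ _ measurableSet_Ioi]
    simp only [transitionKernel_apply]
    rw [lintegral_transitionLaw_Ioi, transitionLaw_Ioi, transitionLaw_Ioi]
    have hst : z - ((s + t : ℝ≥0) : ℝ) = z - t - s := by push_cast; ring
    rw [hst]
    by_cases h : y ∈ Ioi (z - t - s)
    · rw [indicator_of_mem h, indicator_of_mem h, ← ENNReal.ofReal_mul (Real.exp_pos _).le,
        ← Real.exp_add]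
      -- The exponents add up: `(1 - e^{-t}) e^z + (1 - e^{-s}) e^{z-t} = (1 - e^{-(s+t)}) e^z`.
      congr 2
      have e1 : Real.exp (z - t) = Real.exp z * Real.exp (-t) := by
        rw [← Real.exp_add]; congr 1
      have e2 : Real.exp (-((s + t : ℝ≥0) : ℝ)) = Real.exp (-s) * Real.exp (-t) := by
        rw [← Real.exp_add]; congr 1; push_cast; ring
      rw [e1, e2]; ring
    · rw [indicator_of_notMem h, indicator_of_notMem h, mul_zero]

lemma bind_transitionKernel_Ioi (ν : Measure ℝ) (t : ℝ≥0) (z : ℝ) :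
    ν.bind (transitionKernel t) (Ioi z) =
      ENNReal.ofReal (Real.exp (-((1 - Real.exp (-t)) * Real.exp z))) * ν (Ioi (z - t)) := by
  rw [Measure.bind_apply measurableSet_Ioi (transitionKernel t).aemeasurable]
  exact lintegral_transitionLaw_Ioi ν t z

lemma invariant_negGumbel (t : ℝ≥0) : Kernel.Invariant (transitionKernel t) negGumbel := by
  have : IsProbabilityMeasure (negGumbel.bind (transitionKernel t)) := inferInstance
  refine ext_of_Ioi fun z => ?_
  rw [bind_transitionKernel_Ioi, negGumbel_Ioi, negGumbel_Ioi,
    ← ENNReal.ofReal_mul (Real.exp_pos _).le, ← Real.exp_add]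
  congr 2
  rw [sub_eq_add_neg z, Real.exp_add]; ring

/-- Invariance expresses the tail at `z` through the tail at `z - n`, which tends to `1`; the
remaining factor tends to the tail of `negGumbel`. Integer times suffice. -/
lemma eq_negGumbel_of_invariant (ν : Measure ℝ) [IsProbabilityMeasure ν]
    (h : ∀ t, Kernel.Invariant (transitionKernel t) ν) : ν = negGumbel := by
  refine ext_of_Ioi fun z => ?_
  have hz : ∀ n : ℕ, ν (Ioi z) = ENNReal.ofReal
      (Real.exp (-((1 - Real.exp (-(n : ℝ))) * Real.exp z))) * ν (Ioi (z - n)) := by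
    intro n
    have := bind_transitionKernel_Ioi ν n z
    rw [(h n).def] at this
    simpa using this
  have hm : Tendsto (fun n : ℕ => ν (Ioi (z - n))) atTop
      (𝓝 (ν (⋃ n : ℕ, Ioi (z - (n : ℝ))))) :=
    tendsto_measure_iUnion_atTop fun m n hmn =>
      Ioi_subset_Ioi (sub_le_sub_left (Nat.cast_le.2 hmn) z)
  have hu : (⋃ n : ℕ, Ioi (z - (n : ℝ))) = univ := by
    refine eq_univ_of_forall fun x => mem_iUnion.2 ?_
    obtain ⟨n, hn⟩ := exists_nat_gt (z - x)
    exact ⟨n, by simp only [mem_Ioi]; linarith⟩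
  rw [hu, measure_univ] at hm
  have he : Tendsto (fun n : ℕ => ENNReal.ofReal
      (Real.exp (-((1 - Real.exp (-(n : ℝ))) * Real.exp z)))) atTop
      (𝓝 (ENNReal.ofReal (Real.exp (-Real.exp z)))) := by
    refine ENNReal.tendsto_ofReal ((Real.continuous_exp.tendsto _).comp ?_)
    have h0 := Real.tendsto_exp_neg_atTop_nhds_zero.comp (tendsto_natCast_atTop_atTop (R := ℝ))
    have := ((h0.const_sub 1).mul_const (Real.exp z)).neg
    simpa using this
  have hl := ENNReal.Tendsto.mul he (Or.inr ENNReal.one_ne_top) hm (Or.inl (by simp))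
  rw [mul_one] at hl
  rw [negGumbel_Ioi]
  refine tendsto_nhds_unique (f := fun _ : ℕ => ν (Ioi z)) (l := atTop) tendsto_const_nhds ?_
  exact hl.congr fun n => (hz n).symm

/-! ### The generator -/

lemma integrable_jumpLaw {g : ℝ → ℝ} (hg : Integrable g (expMeasure 1)) {c : ℝ} (hc : 0 ≤ c) :
    Integrable g (jumpLaw c) := by
  rw [jumpLaw, integrable_withDensity_iff (by fun_prop) (by simp)]
  refine (hg.mul_const c).mono ?_ (ae_of_all _ fun v => ?_)
  · exact hg.aestronglyMeasurable.mul (Measurable.aestronglyMeasurable (by fun_prop))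
  · rw [ENNReal.toReal_ofReal (by positivity), norm_mul (g v), norm_mul (g v) c]
    refine mul_le_mul_of_nonneg_left ?_ (norm_nonneg (g v))
    rw [Real.norm_of_nonneg (by positivity), Real.norm_of_nonneg hc]
    exact mul_le_of_le_one_right hc (Real.exp_le_one_iff.2 (by simp; positivity))

lemma integral_jumpLaw (g : ℝ → ℝ) {c : ℝ} (hc : 0 ≤ c) :
    ∫ v, g v ∂(jumpLaw c) =
      c * ∫ v in Ioi (0 : ℝ), g v * Real.exp (-v) * Real.exp (-(c * Real.exp (-v))) := by
  rw [jumpLaw, integral_withDensity_eq_integral_toReal_smul (by fun_prop) (by simp),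
    integral_expMeasure_one, ← integral_const_mul]
  refine integral_congr_ae (ae_of_all _ fun v => ?_)
  simp only [smul_eq_mul]
  rw [ENNReal.toReal_ofReal (by positivity)]; ring

variable {f : ℝ → ℝ}

lemma integrable_comp_sub_jumpLaw
    (hfi : ∀ y, IntegrableOn (fun u => f (y - u) * Real.exp (-u)) (Ioi 0)) (w : ℝ) {c : ℝ}
    (hc : 0 ≤ c) : Integrable (fun v => f (w - v)) (jumpLaw c) :=
  integrable_jumpLaw (integrable_expMeasure_one_iff.2 (hfi w)) hc

lemma integrable_transitionLaw (hf : Continuous f)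
    (hfi : ∀ y, IntegrableOn (fun u => f (y - u) * Real.exp (-u)) (Ioi 0)) (t : ℝ≥0) (y : ℝ) :
    Integrable f (transitionLaw t y) := by
  refine Integrable.add_measure ?_ ?_
  · exact (integrable_dirac (by simp)).smul_measure (by simp)
  · rw [integrable_map_measure hf.aestronglyMeasurable (by fun_prop)]
    exact integrable_comp_sub_jumpLaw hfi _ (jumpIntensity_nonneg t y)

/-- The substitution `v = u + t` moves the time out of the argument of `f` into the domain and the
weight. Only `f (y - u)` is left, which has an integrable bound although `f` is not controlled near
`-∞` in any uniform way. -/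
lemma integral_transitionLaw (hf : Continuous f)
    (hfi : ∀ y, IntegrableOn (fun u => f (y - u) * Real.exp (-u)) (Ioi 0)) (t : ℝ≥0) (y : ℝ) :
    ∫ z, f z ∂(transitionLaw t y) = Real.exp (-jumpIntensity t y) * f (y + t) +
      jumpIntensity t y * (Real.exp (-t) * ∫ u in Ioi (-(t : ℝ)), f (y - u) * Real.exp (-u) *
        Real.exp (-(jumpIntensity t y * Real.exp (-(u + t))))) := by
  have hc := jumpIntensity_nonneg t y
  rw [transitionLaw, integral_add_measure, integral_smul_measure, integral_dirac,
    integral_map (by fun_prop) hf.aestronglyMeasurable, integral_jumpLaw _ hc,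
    ENNReal.toReal_ofReal (Real.exp_pos _).le, smul_eq_mul]
  · congr 2
    rw [← integral_const_mul]
    have hmp := (measurePreserving_add_right (volume : Measure ℝ) (t : ℝ))
    have hpre : (fun u : ℝ => u + t) ⁻¹' Ioi 0 = Ioi (-(t : ℝ)) := by
      ext u; simp only [mem_preimage, mem_Ioi]; constructor <;> intro h <;> linarith
    rw [← hpre, ← hmp.setIntegral_preimage_emb (measurableEmbedding_addRight (t : ℝ))]
    refine integral_congr_ae (ae_of_all _ fun u => ?_)
    simp only
    rw [neg_add u, Real.exp_add, show y + t - (u + t) = y - u by ring]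
    ring
  · exact (integrable_dirac (by simp)).smul_measure (by simp)
  · rw [integrable_map_measure hf.aestronglyMeasurable (by fun_prop)]
    exact integrable_comp_sub_jumpLaw hfi _ (jumpIntensity_nonneg t y)

lemma tendsto_setIntegral_Ioi_neg
    (hfi : ∀ y, IntegrableOn (fun u => f (y - u) * Real.exp (-u)) (Ioi 0)) (y : ℝ) :
    Tendsto (fun t : ℝ≥0 => ∫ u in Ioi (-(t : ℝ)), f (y - u) * Real.exp (-u) *
        Real.exp (-(jumpIntensity t y * Real.exp (-(u + t))))) (𝓝[>] 0)
      (𝓝 (∫ u in Ioi (0 : ℝ), f (y - u) * Real.exp (-u))) := by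
  -- For `t ≤ 1` all the domains lie in `(-1, ∞)`; integrability there is the hypothesis at `y + 1`,
  -- translated by one.
  have hdom : IntegrableOn (fun u => f (y - u) * Real.exp (-u)) (Ioi (-1)) := by
    have hmp := (measurePreserving_add_right (volume : Measure ℝ) 1)
    have hpre : (fun u : ℝ => u + 1) ⁻¹' Ioi 0 = Ioi (-1) := by
      ext u; simp only [mem_preimage, mem_Ioi]; constructor <;> intro h <;> linarith
    have h := (hmp.integrableOn_comp_preimage (measurableEmbedding_addRight (1 : ℝ))).2
      (hfi (y + 1))
    rw [hpre] at h
    refine (h.mul_const (Real.exp 1)).congr (ae_of_all _ fun u => ?_)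
    simp only [Function.comp]
    rw [mul_assoc, ← Real.exp_add, show y + 1 - (u + 1) = y - u by ring]
    congr 2; ring
  simp_rw [← integral_indicator measurableSet_Ioi]
  have hle : ∀ᶠ t : ℝ≥0 in 𝓝[>] 0, t ≤ 1 :=
    nhdsWithin_le_nhds (Iic_mem_nhds one_pos)
  refine tendsto_integral_filter_of_dominated_convergence
    ((Ioi (-1)).indicator fun u => ‖f (y - u) * Real.exp (-u)‖) ?_ ?_
    ((integrable_indicator_iff measurableSet_Ioi).2 hdom.norm) ?_
  · filter_upwards [hle] with t ht
    have ht' : (t : ℝ) ≤ 1 := by exact_mod_cast ht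
    refine (aestronglyMeasurable_indicator_iff measurableSet_Ioi).2 ?_
    refine AEStronglyMeasurable.mul ?_ (Measurable.aestronglyMeasurable (by fun_prop))
    exact (hdom.mono_set (Ioi_subset_Ioi (by linarith))).aestronglyMeasurable
  · filter_upwards [hle] with t ht
    have ht' : (t : ℝ) ≤ 1 := by exact_mod_cast ht
    refine ae_of_all _ fun u => ?_
    by_cases hu : u ∈ Ioi (-(t : ℝ))
    · rw [indicator_of_mem hu, indicator_of_mem (Ioi_subset_Ioi (by linarith) hu), norm_mul]
      refine mul_le_of_le_one_right (norm_nonneg _) ?_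
      rw [Real.norm_of_nonneg (Real.exp_pos _).le, Real.exp_le_one_iff, neg_nonpos]
      exact mul_nonneg (jumpIntensity_nonneg t y) (Real.exp_pos _).le
    · rw [indicator_of_notMem hu, norm_zero]
      exact indicator_nonneg (fun _ _ => norm_nonneg _) _
  -- The indicators of `(-t, ∞)` converge to that of `(0, ∞)` except at `u = 0`.
  · have h0 : ∀ᵐ u : ℝ, u ≠ 0 := by simp [ae_iff]
    filter_upwards [h0] with u hu
    have hcoe : Tendsto (fun t : ℝ≥0 => (t : ℝ)) (𝓝[>] 0) (𝓝 0) :=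
      (NNReal.continuous_coe.tendsto' 0 0 (by simp)).mono_left nhdsWithin_le_nhds
    rcases lt_or_gt_of_ne hu with hu | hu
    · rw [indicator_of_notMem (by simp [hu.le])]
      refine tendsto_const_nhds.congr' ?_
      filter_upwards [hcoe.eventually (Iio_mem_nhds (neg_pos.2 hu))] with t ht
      rw [indicator_of_notMem]
      simp only [mem_Ioi] at ht ⊢; linarith
    · rw [indicator_of_mem (by exact hu)]
      have hlim : Tendsto (fun t : ℝ≥0 => f (y - u) * Real.exp (-u) *
          Real.exp (-(jumpIntensity t y * Real.exp (-(u + t))))) (𝓝[>] 0)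
          (𝓝 (f (y - u) * Real.exp (-u) *
            Real.exp (-(((Real.exp 0 - 1) * Real.exp y) * Real.exp (-(u + 0)))))) := by
        have hc : Continuous fun r : ℝ => f (y - u) * Real.exp (-u) *
          Real.exp (-(((Real.exp r - 1) * Real.exp y) * Real.exp (-(u + r)))) := by fun_prop
        exact (hc.tendsto 0).comp hcoe
      simp only [Real.exp_zero, sub_self, zero_mul, neg_zero, mul_one] at hlim
      refine hlim.congr fun t => ?_
      rw [indicator_of_mem]
      have := t.coe_nonneg
      simp only [mem_Ioi]; linarith

theorem tendsto_generator (hf : ContDiff ℝ 1 f)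
    (hfi : ∀ y, IntegrableOn (fun u => f (y - u) * Real.exp (-u)) (Ioi 0)) (y : ℝ) :
    Tendsto (fun t : ℝ≥0 => ((∫ z, f z ∂(transitionLaw t y)) - f y) / (t : ℝ)) (𝓝[>] 0)
      (𝓝 (generator f y)) := by
  have hcoe : Tendsto (fun t : ℝ≥0 => (t : ℝ)) (𝓝[>] 0) (𝓝[≠] 0) := by
    refine tendsto_nhdsWithin_iff.2
      ⟨(NNReal.continuous_coe.tendsto' 0 0 (by simp)).mono_left nhdsWithin_le_nhds, ?_⟩
    filter_upwards [self_mem_nhdsWithin] with t ht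
    exact (NNReal.coe_pos.2 ht).ne'
  have hcoe0 : Tendsto (fun t : ℝ≥0 => (t : ℝ)) (𝓝[>] 0) (𝓝 0) :=
    hcoe.mono_right nhdsWithin_le_nhds
  have hc : HasDerivAt (fun r : ℝ => (Real.exp r - 1) * Real.exp y) (Real.exp y) 0 := by
    simpa using ((Real.hasDerivAt_exp 0).sub_const 1).mul_const (Real.exp y)
  have hfd : HasDerivAt (fun r : ℝ => f (y + r)) (deriv f y) 0 := by
    have : HasDerivAt f (deriv f y) (y + 0) := by
      rw [add_zero]; exact (hf.differentiable one_ne_zero y).hasDerivAt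
    exact this.comp_const_add y 0
  -- The atom contributes a derivative at time `0`, which supplies both the drift term and the loss
  -- term `-e^y f(y)`. The density contributes the slope of the intensity times a convergent
  -- integral.
  have hF : HasDerivAt (fun r : ℝ => Real.exp (-((Real.exp r - 1) * Real.exp y)) * f (y + r))
      (deriv f y - Real.exp y * f y) 0 := by
    convert! (hc.neg.exp).mul hfd using 1
    simp; ring
  have h1 := (hasDerivAt_iff_tendsto_slope_zero.1 hF).comp hcoe
  have h2 := (hasDerivAt_iff_tendsto_slope_zero.1 hc).comp hcoe
  have h3 := tendsto_setIntegral_Ioi_neg hfi y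
  have h4 : Tendsto (fun t : ℝ≥0 => Real.exp (-t)) (𝓝[>] 0) (𝓝 1) := by
    have : Continuous fun r : ℝ => Real.exp (-r) := by fun_prop
    simpa [Function.comp_def] using (this.tendsto 0).comp hcoe0
  have hlim := h1.add (h2.mul (h4.mul h3))
  have hgen : generator f y = deriv f y - Real.exp y * f y +
      Real.exp y * (1 * ∫ u in Ioi (0 : ℝ), f (y - u) * Real.exp (-u)) := by
    have hexp : IntegrableOn (fun u : ℝ => Real.exp (-u)) (Ioi 0) := by
      simpa using integrableOn_exp_neg_Ioi 0
    have : ∫ u in Ioi (0 : ℝ), (f (y - u) - f y) * Real.exp (-u) =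
        (∫ u in Ioi (0 : ℝ), f (y - u) * Real.exp (-u)) - f y := by
      simp_rw [sub_mul]
      rw [integral_sub (hfi y) (hexp.const_mul _), integral_const_mul, integral_exp_neg_Ioi]
      simp
    rw [generator, this]; ring
  rw [hgen]
  refine hlim.congr fun t => ?_
  rw [integral_transitionLaw hf.continuous hfi]
  simp only [Function.comp, smul_eq_mul, jumpIntensity, zero_add, Real.exp_zero, sub_self,
    zero_mul, neg_zero, add_zero, one_mul, sub_zero]
  ring

end BrownianInterlacement

/-! ### Deterministic analysis of drift paths: counting jumps and Riemann sums along a grid. -/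

namespace BrownianInterlacement

variable {Ω : Type*}

/-! ### Paths with unit drift and isolated jumps -/

/-- The path `X · ω` is càdlàg, and away from isolated jumps it has slope one. -/
def IsDriftJumpPath (X : ℝ → Ω → ℝ) (ω : Ω) : Prop :=
  ∀ r, (∀ᶠ q in 𝓝[>] r, X q ω - q = X r ω - r) ∧ ∃ l, ∀ᶠ q in 𝓝[<] r, X q ω - q = l

/-- During `(a, b]`, the path `X · ω` is a unit drift with at most one jump. -/
def HasAtMostOneJump (X : ℝ → Ω → ℝ) (ω : Ω) (a b : ℝ) : Prop :=
  (jumpTimes X ω a b = ∅ ∧ X b ω - X a ω = b - a) ∨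
    ∃ r, jumpTimes X ω a b = {r} ∧ X b ω - X a ω = b - a - jumpSize X ω r

variable {X : ℝ → Ω → ℝ} {ω : Ω}

lemma jumpSize_eq_of_eventually {r l : ℝ} (h : ∀ᶠ q in 𝓝[<] r, X q ω - q = l) :
    jumpSize X ω r = l + r - X r ω := by
  have : Tendsto (fun q => X q ω) (𝓝[<] r) (𝓝 (l + r)) := by
    have h1 : Tendsto (fun q : ℝ => l + q) (𝓝[<] r) (𝓝 (l + r)) :=
      ((continuous_const.add continuous_id).tendsto r).mono_left nhdsWithin_le_nhds
    refine h1.congr' ?_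
    filter_upwards [h] with q hq
    linarith
  rw [jumpSize, leftLim_eq_of_tendsto this]

lemma IsDriftJumpPath.cadlag (h : IsDriftJumpPath X ω) (t : ℝ) :
    ContinuousWithinAt (fun s => X s ω) (Ici t) t ∧
      ∃ l, Tendsto (fun s => X s ω) (𝓝[<] t) (𝓝 l) := by
  obtain ⟨hr, l, hl⟩ := h t
  constructor
  · rw [continuousWithinAt_Ioi_iff_Ici.symm]
    have h1 : Tendsto (fun q : ℝ => X t ω - t + q) (𝓝[>] t) (𝓝 (X t ω - t + t)) :=
      ((continuous_const.add continuous_id).tendsto t).mono_left nhdsWithin_le_nhds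
    rw [sub_add_cancel] at h1
    refine Tendsto.congr' ?_ h1
    filter_upwards [hr] with q hq
    linarith
  · refine ⟨l + t, ?_⟩
    have h1 : Tendsto (fun q : ℝ => l + q) (𝓝[<] t) (𝓝 (l + t)) :=
      ((continuous_const.add continuous_id).tendsto t).mono_left nhdsWithin_le_nhds
    refine h1.congr' ?_
    filter_upwards [hl] with q hq
    linarith

lemma IsDriftJumpPath.exists_hasAtMostOneJump_near (h : IsDriftJumpPath X ω) (r : ℝ) :
    ∃ ε > 0, ∀ a b, a ≤ b → r - ε < a → b < r + ε → HasAtMostOneJump X ω a b := by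
  obtain ⟨hr, l, hl⟩ := h r
  obtain ⟨u, hu, hur⟩ := mem_nhdsGT_iff_exists_Ioo_subset.1 hr
  obtain ⟨v, hv, hvr⟩ := mem_nhdsLT_iff_exists_Ioo_subset.1 hl
  simp only [mem_Ioi, mem_Iio] at hu hv
  have hright : ∀ q, r ≤ q → q < u → X q ω - q = X r ω - r := by
    intro q hq hqu
    rcases hq.eq_or_lt with rfl | hq
    · rfl
    · exact hur ⟨hq, hqu⟩
  have hleft : ∀ q, v < q → q < r → X q ω - q = l := fun q h1 h2 => hvr ⟨h1, h2⟩
  have hjr : jumpSize X ω r = l + r - X r ω := jumpSize_eq_of_eventually hl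
  have hj0 : ∀ q, v < q → q < u → q ≠ r → jumpSize X ω q = 0 := by
    intro q hvq hqu hqr
    rcases lt_or_gt_of_ne hqr with hq | hq
    · rw [jumpSize_eq_of_eventually (l := l), ← hleft q hvq hq]
      · ring
      · filter_upwards [Ioo_mem_nhdsLT hvq] with p hp
        exact hleft p hp.1 (hp.2.trans hq)
    · rw [jumpSize_eq_of_eventually (l := X r ω - r), ← hright q hq.le hqu]
      · ring
      · filter_upwards [Ioo_mem_nhdsLT hq] with p hp
        exact hright p hp.1.le (hp.2.trans hqu)
  refine ⟨min (u - r) (r - v), lt_min (by linarith) (by linarith), fun a b hab ha hb => ?_⟩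
  have hva : v < a := by have := min_le_right (u - r) (r - v); linarith
  have hbu : b < u := by have := min_le_left (u - r) (r - v); linarith
  have hsub : jumpTimes X ω a b ⊆ {r} := by
    rintro q ⟨⟨haq, hqb⟩, hq⟩
    by_contra hqr
    exact hq (hj0 q (hva.trans haq) (hqb.trans_lt hbu) hqr)
  rcases subset_singleton_iff_eq.1 hsub with he | he
  · refine Or.inl ⟨he, ?_⟩
    rcases le_or_gt r a with hra | har
    · linarith [hright a hra (hab.trans_lt hbu), hright b (hra.trans hab) hbu]
    · rcases lt_or_ge b r with hbr | hrb
      · linarith [hleft a hva har, hleft b (hva.trans_le hab) hbr]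
      · have h0 : jumpSize X ω r = 0 := by
          by_contra hne
          have : r ∈ jumpTimes X ω a b := ⟨⟨har, hrb⟩, hne⟩
          rw [he] at this; exact this
        linarith [hleft a hva har, hright b hrb hbu]
  · have hr : r ∈ jumpTimes X ω a b := by rw [he]; rfl
    obtain ⟨⟨har, hrb⟩, -⟩ := hr
    exact Or.inr ⟨r, he, by linarith [hleft a hva har, hright b hrb hbu]⟩

/-- `δ` is a Lebesgue number of the cover of `[s, t]` by the neighbourhoods of the local statement.
-/
lemma IsDriftJumpPath.exists_hasAtMostOneJump (h : IsDriftJumpPath X ω) (s t : ℝ) :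
    ∃ δ > 0, ∀ a b, s ≤ a → a ≤ b → b ≤ t → b - a < δ → HasAtMostOneJump X ω a b := by
  choose ε hε hJ using h.exists_hasAtMostOneJump_near
  obtain ⟨δ, hδ, hball⟩ := lebesgue_number_lemma_of_metric (isCompact_Icc (a := s) (b := t))
    (c := fun r => Metric.ball r (ε r)) (fun r => Metric.isOpen_ball)
    (fun r _ => mem_iUnion.2 ⟨r, Metric.mem_ball_self (hε r)⟩)
  refine ⟨δ, hδ, fun a b hsa hab hbt hlt => ?_⟩
  obtain ⟨r, hr⟩ := hball a ⟨hsa, hab.trans hbt⟩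
  have ha := hr (Metric.mem_ball_self hδ)
  have hb : b ∈ Metric.ball r (ε r) := by
    refine hr ?_
    rw [Metric.mem_ball, Real.dist_eq, abs_of_nonneg (by linarith)]; exact hlt
  rw [Metric.mem_ball, Real.dist_eq, abs_lt] at ha hb
  exact hJ r a b hab (by linarith) (by linarith)

/-! ### Subdivisions of a time interval -/

/-- The points of the subdivision of `[s, t]` into `n + 1` intervals of equal length. -/
def gridPoint (s t : ℝ) (n i : ℕ) : ℝ := s + i * ((t - s) / (n + 1))

lemma gridPoint_zero (s t : ℝ) (n : ℕ) : gridPoint s t n 0 = s := by simp [gridPoint]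

lemma gridPoint_last (s t : ℝ) (n : ℕ) : gridPoint s t n (n + 1) = t := by
  rw [gridPoint]; push_cast; field_simp; ring

lemma gridPoint_succ (s t : ℝ) (n i : ℕ) :
    gridPoint s t n (i + 1) = gridPoint s t n i + (t - s) / (n + 1) := by
  rw [gridPoint, gridPoint]; push_cast; ring

lemma monotone_gridPoint {s t : ℝ} (hst : s ≤ t) (n : ℕ) : Monotone (gridPoint s t n) := by
  refine monotone_nat_of_le_succ fun i => ?_
  rw [gridPoint_succ]
  have : 0 ≤ (t - s) / ((n : ℝ) + 1) := div_nonneg (by linarith) (by positivity)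
  linarith

lemma le_gridPoint {s t : ℝ} (hst : s ≤ t) (n i : ℕ) : s ≤ gridPoint s t n i :=
  (gridPoint_zero s t n).symm.le.trans (monotone_gridPoint hst n (Nat.zero_le i))

lemma gridPoint_le {s t : ℝ} (hst : s ≤ t) {n i : ℕ} (hi : i ≤ n + 1) : gridPoint s t n i ≤ t :=
  (monotone_gridPoint hst n hi).trans (gridPoint_last s t n).le

lemma tendsto_mesh (s t : ℝ) : Tendsto (fun n : ℕ => (t - s) / ((n : ℝ) + 1)) atTop (𝓝 0) :=
  tendsto_const_nhds.div_atTop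
    (tendsto_atTop_add_const_right _ 1 (tendsto_natCast_atTop_atTop (R := ℝ)))

lemma jumpTimes_union {a b c : ℝ} (hab : a ≤ b) (hbc : b ≤ c) :
    jumpTimes X ω a c = jumpTimes X ω a b ∪ jumpTimes X ω b c := by
  ext r
  simp only [jumpTimes, mem_ofPred_eq, mem_union, ← or_and_right, ← Ioc_union_Ioc_eq_Ioc hab hbc]

lemma disjoint_jumpTimes (a b c : ℝ) : Disjoint (jumpTimes X ω a b) (jumpTimes X ω b c) :=
  (Ioc_disjoint_Ioc_of_le le_rfl).mono (fun _ h => h.1) (fun _ h => h.1)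

lemma jumpCount_add {a b c : ℝ} (hab : a ≤ b) (hbc : b ≤ c) (A : Set ℝ) :
    jumpCount X a c A ω = jumpCount X a b A ω + jumpCount X b c A ω := by
  have h : {r ∈ jumpTimes X ω a c | jumpSize X ω r ∈ A} =
      {r ∈ jumpTimes X ω a b | jumpSize X ω r ∈ A} ∪
        {r ∈ jumpTimes X ω b c | jumpSize X ω r ∈ A} := by
    rw [jumpTimes_union hab hbc]; ext r; simp [or_and_right]
  rw [jumpCount, h, encard_union_eq, jumpCount, jumpCount, ENat.toENNReal_add]
  exact (disjoint_jumpTimes a b c).mono (fun _ h => h.1) (fun _ h => h.1)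

lemma jumpCount_self (a : ℝ) (A : Set ℝ) : jumpCount X a a A ω = 0 := by
  simp [jumpCount, jumpTimes]

lemma sum_jumpCount {τ : ℕ → ℝ} (hτ : Monotone τ) (A : Set ℝ) (n : ℕ) :
    ∑ i ∈ Finset.range n, jumpCount X (τ i) (τ (i + 1)) A ω =
      jumpCount X (τ 0) (τ n) A ω := by
  induction n with
  | zero => simp [jumpCount_self]
  | succ n ih =>
    rw [Finset.sum_range_succ, ih, ← jumpCount_add (hτ (Nat.zero_le n)) (hτ n.le_succ)]

lemma IsDriftJumpPath.equation (h : IsDriftJumpPath X ω) {s t : ℝ} (hst : s ≤ t) :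
    (jumpTimes X ω s t).Finite ∧
      X t ω - X s ω = (t - s) - ∑ᶠ r ∈ jumpTimes X ω s t, jumpSize X ω r := by
  obtain ⟨δ, hδ, hJ⟩ := h.exists_hasAtMostOneJump s t
  obtain ⟨n, hn⟩ := ((tendsto_mesh s t).eventually (gt_mem_nhds hδ)).exists
  have hmono := monotone_gridPoint hst n
  have key : ∀ i ≤ n + 1, (jumpTimes X ω s (gridPoint s t n i)).Finite ∧
      X (gridPoint s t n i) ω - X s ω = (gridPoint s t n i - s) -
        ∑ᶠ r ∈ jumpTimes X ω s (gridPoint s t n i), jumpSize X ω r := by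
    intro i
    induction i with
    | zero => intro; simp [gridPoint_zero, jumpTimes]
    | succ i ih =>
      intro hi
      obtain ⟨hfin, heq⟩ := ih (by omega)
      rw [jumpTimes_union (le_gridPoint hst n i) (hmono i.le_succ)]
      have hone := hJ (gridPoint s t n i) (gridPoint s t n (i + 1)) (le_gridPoint hst n i)
        (hmono i.le_succ) (gridPoint_le hst hi) (by rw [gridPoint_succ]; linarith)
      rcases hone with ⟨he, hd⟩ | ⟨r, he, hd⟩
      · rw [he, union_empty]
        exact ⟨hfin, by linarith⟩
      · have hdisj := disjoint_jumpTimes (X := X) (ω := ω) s (gridPoint s t n i)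
          (gridPoint s t n (i + 1))
        rw [he] at hdisj ⊢
        refine ⟨hfin.union (finite_singleton r), ?_⟩
        rw [finsum_mem_union hdisj hfin (finite_singleton r), finsum_mem_singleton]
        linarith
  simpa only [gridPoint_last] using key (n + 1) le_rfl

/-- Amount by which the increment of `X` over the `i`-th interval of the subdivision falls short
of the drift. -/
def gridDrop (X : ℝ → Ω → ℝ) (s t : ℝ) (n i : ℕ) (ω : Ω) : ℝ :=
  X (gridPoint s t n i) ω + (t - s) / (n + 1) - X (gridPoint s t n (i + 1)) ω

/-- A cell without jumps has drop `0`, which is not in `A`. The bound counts jumps of all sizes,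
because on a coarse grid several jumps may add up to a drop in `A` though none of them is in `A`. It
holds for every mesh, hence serves as a dominating function. -/
lemma IsDriftJumpPath.indicator_gridDrop_le (h : IsDriftJumpPath X ω) {s t : ℝ} (hst : s ≤ t)
    {A : Set ℝ} (hA : 0 ∉ A) (n i : ℕ) :
    A.indicator (1 : ℝ → ℝ≥0∞) (gridDrop X s t n i ω) ≤
      jumpCount X (gridPoint s t n i) (gridPoint s t n (i + 1)) univ ω := by
  rcases eq_empty_or_nonempty (jumpTimes X ω (gridPoint s t n i) (gridPoint s t n (i + 1)))
    with he | hne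
  · have heq := (h.equation (monotone_gridPoint hst n i.le_succ)).2
    rw [Nat.succ_eq_add_one, he, finsum_mem_empty] at heq
    have h0 : gridDrop X s t n i ω = 0 := by
      rw [gridDrop]; linarith [gridPoint_succ s t n i]
    rw [h0, indicator_of_notMem hA]; exact zero_le
  · refine (indicator_le_self _ _ _).trans ?_
    have : 1 ≤ (jumpTimes X ω (gridPoint s t n i) (gridPoint s t n (i + 1))).encard :=
      one_le_encard_iff_nonempty.2 hne
    simpa [jumpCount] using ENat.toENNReal_le.2 this

lemma IsDriftJumpPath.sum_indicator_gridDrop_le (h : IsDriftJumpPath X ω) {s t : ℝ}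
    (hst : s ≤ t) {A : Set ℝ} (hA : 0 ∉ A) (n : ℕ) :
    ∑ i ∈ Finset.range (n + 1), A.indicator (1 : ℝ → ℝ≥0∞) (gridDrop X s t n i ω) ≤
      jumpCount X s t univ ω := by
  refine (Finset.sum_le_sum fun i _ => h.indicator_gridDrop_le hst hA n i).trans ?_
  rw [sum_jumpCount (monotone_gridPoint hst n), gridPoint_zero, gridPoint_last]

lemma HasAtMostOneJump.jumpCount_eq {a b : ℝ} (h : HasAtMostOneJump X ω a b) {A : Set ℝ}
    (hA : 0 ∉ A) :
    jumpCount X a b A ω = A.indicator 1 (X a ω + (b - a) - X b ω) := by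
  rcases h with ⟨he, hd⟩ | ⟨r, he, hd⟩
  · have h0 : X a ω + (b - a) - X b ω = 0 := by linarith
    rw [jumpCount, he, h0, indicator_of_notMem hA]; simp
  · have h0 : X a ω + (b - a) - X b ω = jumpSize X ω r := by linarith
    rw [jumpCount, he, h0]
    by_cases hr : jumpSize X ω r ∈ A
    · have : {q ∈ ({r} : Set ℝ) | jumpSize X ω q ∈ A} = {r} := by
        ext q; simp only [mem_singleton_iff, mem_ofPred_eq, and_iff_left_iff_imp]
        rintro rfl; exact hr
      rw [this, indicator_of_mem hr]; simp
    · have : {q ∈ ({r} : Set ℝ) | jumpSize X ω q ∈ A} = ∅ := by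
        ext q; simp only [mem_singleton_iff, mem_ofPred_eq, mem_empty_iff_false, iff_false]
        rintro ⟨rfl, hq⟩; exact hr hq
      rw [this, indicator_of_notMem hr]; simp

/-- The sequence is eventually constant: once each cell has at most one jump, its drop is the size
of that jump. -/
lemma IsDriftJumpPath.tendsto_sum_indicator_gridDrop (h : IsDriftJumpPath X ω) {s t : ℝ}
    (hst : s ≤ t) {A : Set ℝ} (hA : 0 ∉ A) :
    Tendsto (fun n => ∑ i ∈ Finset.range (n + 1),
        A.indicator (1 : ℝ → ℝ≥0∞) (gridDrop X s t n i ω)) atTop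
      (𝓝 (jumpCount X s t A ω)) := by
  obtain ⟨δ, hδ, hJ⟩ := h.exists_hasAtMostOneJump s t
  refine tendsto_const_nhds.congr' ?_
  filter_upwards [(tendsto_mesh s t).eventually (gt_mem_nhds hδ)] with n hn
  have hmono := monotone_gridPoint hst n
  have hs := sum_jumpCount (X := X) (ω := ω) hmono A (n + 1)
  rw [gridPoint_zero, gridPoint_last] at hs
  rw [← hs]
  refine Finset.sum_congr rfl fun i hi => ?_
  have hone := hJ (gridPoint s t n i) (gridPoint s t n (i + 1)) (le_gridPoint hst n i)
    (hmono i.le_succ) (gridPoint_le hst (by have := Finset.mem_range.1 hi; omega))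
    (by rw [gridPoint_succ]; linarith)
  rw [hone.jumpCount_eq hA, gridDrop, gridPoint_succ, add_sub_cancel_left]

/-- Jumps are nonzero by definition. This reduces mark sets to those avoiding `0`, for which quiet
cells count for nothing. -/
lemma jumpCount_diff_zero (s t : ℝ) (A : Set ℝ) :
    jumpCount X s t (A \ {0}) ω = jumpCount X s t A ω := by
  have : {r ∈ jumpTimes X ω s t | jumpSize X ω r ∈ A \ {0}} =
      {r ∈ jumpTimes X ω s t | jumpSize X ω r ∈ A} := by
    ext r; simp only [jumpTimes, mem_ofPred_eq, Set.mem_sdiff, mem_singleton_iff]; tauto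
  rw [jumpCount, this, jumpCount]

/-! ### Riemann sums along paths with drift at most one -/

lemma intervalIntegrable_exp_of_antitone {x : ℝ → ℝ} (hx : Antitone fun r => x r - r) (a b : ℝ) :
    IntervalIntegrable (fun r => Real.exp (x r)) volume a b := by
  have h1 : Antitone fun r => Real.exp (x r - r) := fun p q h => Real.exp_le_exp.2 (hx h)
  have h2 := (h1.intervalIntegrable (μ := volume) (a := a) (b := b)).mul_continuousOn
    (g := Real.exp) Real.continuous_exp.continuousOn
  refine h2.congr fun r _ => ?_
  rw [← Real.exp_add, sub_add_cancel]

/-- Within a cell of length `h` the path rises by at most `h`. Comparing the left endpoints with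
later times bounds the sum from below by `e^{-h}` times the integral; comparing the right endpoints
with earlier times bounds the shifted sum from above by `e^h` times it. The shift costs one boundary
term, of order `h`. -/
lemma tendsto_riemannSum_exp {x : ℝ → ℝ} (hx : Antitone fun r => x r - r) {s t : ℝ}
    (hst : s ≤ t) :
    Tendsto (fun n : ℕ => (t - s) / ((n : ℝ) + 1) *
        ∑ i ∈ Finset.range (n + 1), Real.exp (x (gridPoint s t n i))) atTop
      (𝓝 (∫ r in s..t, Real.exp (x r))) := by
  set I := ∫ r in s..t, Real.exp (x r)
  have hfi := intervalIntegrable_exp_of_antitone hx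
  have hsum : ∀ n : ℕ, ∑ i ∈ Finset.range (n + 1),
      ∫ r in gridPoint s t n i..gridPoint s t n (i + 1), Real.exp (x r) = I := by
    intro n
    rw [intervalIntegral.sum_integral_adjacent_intervals fun i _ => hfi _ _, gridPoint_zero,
      gridPoint_last]
  have hconst : ∀ (n i : ℕ) (c : ℝ),
      ∫ r in gridPoint s t n i..gridPoint s t n (i + 1), c = (t - s) / ((n : ℝ) + 1) * c := by
    intro n i c
    rw [intervalIntegral.integral_const, gridPoint_succ, add_sub_cancel_left, smul_eq_mul]
  have hh : ∀ n : ℕ, 0 ≤ (t - s) / ((n : ℝ) + 1) :=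
    fun n => div_nonneg (by linarith) (by positivity)
  have hlow : ∀ n : ℕ, Real.exp (-((t - s) / ((n : ℝ) + 1))) * I ≤ (t - s) / ((n : ℝ) + 1) *
      ∑ i ∈ Finset.range (n + 1), Real.exp (x (gridPoint s t n i)) := by
    intro n
    rw [← hsum n, Finset.mul_sum, Finset.mul_sum]
    refine Finset.sum_le_sum fun i _ => ?_
    rw [← intervalIntegral.integral_const_mul, ← hconst n i]
    refine intervalIntegral.integral_mono_on (monotone_gridPoint hst n i.le_succ)
      ((hfi _ _).const_mul _) (by simp) fun r hr => ?_
    rw [← Real.exp_add, Real.exp_le_exp]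
    have h1 := hx hr.1
    have h2 := hr.2
    rw [gridPoint_succ] at h2
    simp only at h1
    linarith
  have hup : ∀ n : ℕ, (t - s) / ((n : ℝ) + 1) *
      ∑ i ∈ Finset.range (n + 1), Real.exp (x (gridPoint s t n i)) ≤
      Real.exp ((t - s) / ((n : ℝ) + 1)) * I + (t - s) / ((n : ℝ) + 1) * Real.exp (x s) := by
    intro n
    have hshift : (t - s) / ((n : ℝ) + 1) * ∑ i ∈ Finset.range (n + 1),
        Real.exp (x (gridPoint s t n (i + 1))) ≤ Real.exp ((t - s) / ((n : ℝ) + 1)) * I := by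
      rw [← hsum n, Finset.mul_sum, Finset.mul_sum]
      refine Finset.sum_le_sum fun i _ => ?_
      rw [← intervalIntegral.integral_const_mul, ← hconst n i]
      refine intervalIntegral.integral_mono_on (monotone_gridPoint hst n i.le_succ)
        (by simp) ((hfi _ _).const_mul _) fun r hr => ?_
      rw [← Real.exp_add, Real.exp_le_exp]
      have h1 := hx hr.2
      have h2 := hr.1
      have h3 := gridPoint_succ s t n i
      simp only at h1
      linarith
    have htel : ∑ i ∈ Finset.range (n + 1), Real.exp (x (gridPoint s t n i)) ≤
        (∑ i ∈ Finset.range (n + 1), Real.exp (x (gridPoint s t n (i + 1)))) +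
          Real.exp (x s) := by
      have h1 := Finset.sum_range_succ' (fun i => Real.exp (x (gridPoint s t n i))) (n + 1)
      have h2 := Finset.sum_range_succ (fun i => Real.exp (x (gridPoint s t n i))) (n + 1)
      rw [gridPoint_zero] at h1
      have h3 := Real.exp_pos (x (gridPoint s t n (n + 1)))
      linarith
    have := mul_le_mul_of_nonneg_left htel (hh n)
    rw [mul_add] at this
    linarith
  have hm := tendsto_mesh s t
  refine tendsto_of_tendsto_of_tendsto_of_le_of_le ?_ ?_ hlow hup
  · have := (((Real.continuous_exp.tendsto _).comp hm.neg)).mul_const I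
    simpa [Function.comp_def] using this
  · have := (((Real.continuous_exp.tendsto _).comp hm).mul_const I).add
      (hm.mul_const (Real.exp (x s)))
    simpa [Function.comp_def] using this

end BrownianInterlacement

/-! ### From void probabilities to stationarity, one-dimensional laws and the Markov property. -/

namespace BrownianInterlacement

/-! ### Cylinders that generate the product σ-algebra -/

/-- The set of the functions that exceed the value `p.2` at `p.1`, for each `p ∈ L`. -/
def upperCylinder {ι : Type*} (L : Finset (ι × ℝ)) : Set (ι → ℝ) := {f | ∀ p ∈ L, p.2 < f p.1}

lemma measurableSet_upperCylinder {ι : Type*} (L : Finset (ι × ℝ)) :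
    MeasurableSet (upperCylinder L) := by
  have : upperCylinder L = ⋂ p ∈ L, {f : ι → ℝ | p.2 < f p.1} := by
    ext f; simp [upperCylinder]
  rw [this]
  exact L.measurableSet_biInter fun p _ =>
    measurableSet_lt measurable_const (measurable_pi_apply p.1)

/-- A finite set of pairs may hold several levels for one index, so an intersection of cylinders is
simply the union of their lists of constraints. -/
lemma isPiSystem_upperCylinder (ι : Type*) :
    IsPiSystem (range (upperCylinder : Finset (ι × ℝ) → Set (ι → ℝ))) := by
  classical
  rintro _ ⟨L, rfl⟩ _ ⟨L', rfl⟩ -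
  refine ⟨L ∪ L', ?_⟩
  ext f
  simp only [upperCylinder, mem_ofPred_eq, mem_inter_iff, Finset.mem_union]
  exact ⟨fun h => ⟨fun p hp => h p (Or.inl hp), fun p hp => h p (Or.inr hp)⟩,
    fun h p hp => hp.elim (h.1 p) (h.2 p)⟩

lemma generateFrom_upperCylinder (ι : Type*) :
    MeasurableSpace.generateFrom (range (upperCylinder : Finset (ι × ℝ) → Set (ι → ℝ))) =
      MeasurableSpace.pi := by
  refine le_antisymm (MeasurableSpace.generateFrom_le ?_) (iSup_le fun i => ?_)
  · rintro _ ⟨L, rfl⟩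
    exact measurableSet_upperCylinder L
  · rw [BorelSpace.measurable_eq (α := ℝ), borel_eq_generateFrom_Ioi ℝ,
      MeasurableSpace.comap_generateFrom]
    refine MeasurableSpace.generateFrom_mono ?_
    rintro _ ⟨_, ⟨z, rfl⟩, rfl⟩
    exact ⟨{(i, z)}, by ext f; simp [upperCylinder]⟩

lemma isCountablySpanning_upperCylinder (ι : Type*) :
    IsCountablySpanning (range (upperCylinder : Finset (ι × ℝ) → Set (ι → ℝ))) :=
  ⟨fun _ => univ, fun _ => ⟨∅, by ext f; simp [upperCylinder]⟩, iUnion_const univ⟩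

lemma isCountablySpanning_Ioi : IsCountablySpanning (range (Ioi : ℝ → Set ℝ)) := by
  refine ⟨fun n => Ioi (-(n : ℝ)), fun n => mem_range_self _,
    eq_univ_of_forall fun x => mem_iUnion.2 ?_⟩
  obtain ⟨n, hn⟩ := exists_nat_gt (-x)
  exact ⟨n, by simp only [mem_Ioi]; linarith⟩

/-! ### The boxes that have to be void of points -/

/-- The intensity measure of the points of the interlacement. -/
def pointRate : Measure (ℝ × ℝ) :=
  (volume : Measure ℝ).prod ((volume : Measure ℝ).restrict (Ici 0))

/-- The box that is void of points if and only if the process exceeds `y` at time `β`. -/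
def voidBox (β y : ℝ) : Set (ℝ × ℝ) := Icc 0 (Real.exp (y - β) / 2) ×ˢ Iic (2 * Real.exp β)

lemma measurableSet_voidBox (β y : ℝ) : MeasurableSet (voidBox β y) :=
  measurableSet_Icc.prod measurableSet_Iic

/-- The region that has to be void of points for the process to lie in an upper cylinder. -/
def voidRegion (L : Finset (ℝ × ℝ)) : Set (ℝ × ℝ) := ⋃ p ∈ L, voidBox p.1 p.2

lemma measurableSet_voidRegion (L : Finset (ℝ × ℝ)) : MeasurableSet (voidRegion L) :=
  L.measurableSet_biUnion fun p _ => measurableSet_voidBox p.1 p.2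

lemma pointRate_Icc_prod (a b : ℝ) :
    pointRate (Icc 0 a ×ˢ Iic b) = ENNReal.ofReal a * ENNReal.ofReal b := by
  have : Iic b ∩ Ici 0 = Icc 0 b := by ext; simp [and_comm]
  rw [pointRate, Measure.prod_prod, Measure.restrict_apply measurableSet_Iic, this,
    Real.volume_Icc, Real.volume_Icc, sub_zero, sub_zero]

/-- The factors `2` and the time cancel, leaving `e^y`: this is the effect of the terms `β` and `ln
2` in the definition of `Y`. -/
lemma pointRate_voidBox (β y : ℝ) :
    pointRate (voidBox β y) = ENNReal.ofReal (Real.exp y) := by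
  rw [voidBox, pointRate_Icc_prod, ← ENNReal.ofReal_mul (by positivity)]
  congr 1
  rw [Real.exp_sub]
  field_simp

lemma pointRate_voidRegion_ne_top (L : Finset (ℝ × ℝ)) : pointRate (voidRegion L) ≠ ∞ := by
  refine ((measure_biUnion_finset_le L _).trans_lt ?_).ne
  refine ENNReal.sum_lt_top.2 fun p _ => ?_
  rw [pointRate_voidBox]
  exact ENNReal.ofReal_lt_top

/-- The scaling of the points that corresponds to a time shift. -/
def pointScaling (h : ℝ) : ℝ × ℝ → ℝ × ℝ :=
  Prod.map (fun x => Real.exp h * x) (fun u => Real.exp (-h) * u)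

lemma measurePreserving_pointScaling (h : ℝ) :
    MeasurePreserving (pointScaling h) pointRate pointRate := by
  refine ⟨by unfold pointScaling; fun_prop, ?_⟩
  have h1 : Measure.map (fun x => Real.exp h * x) (volume : Measure ℝ) =
      ENNReal.ofReal (Real.exp (-h)) • volume := by
    rw [Real.map_volume_mul_left (Real.exp_pos h).ne', ← Real.exp_neg,
      abs_of_pos (Real.exp_pos _)]
  have h2 : Measure.map (fun x => Real.exp (-h) * x) ((volume : Measure ℝ).restrict (Ici 0)) =
      ENNReal.ofReal (Real.exp h) • (volume : Measure ℝ).restrict (Ici 0) := by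
    have hpre : (fun x => Real.exp (-h) * x) ⁻¹' Ici 0 = Ici 0 := by
      ext x; simp [mul_nonneg_iff_of_pos_left (Real.exp_pos (-h))]
    have := Measure.restrict_map (μ := (volume : Measure ℝ))
      (f := fun x => Real.exp (-h) * x) (by fun_prop) (measurableSet_Ici (a := (0 : ℝ)))
    rw [hpre] at this
    rw [← this, Real.map_volume_mul_left (Real.exp_pos (-h)).ne', ← Real.exp_neg,
      abs_of_pos (Real.exp_pos _), neg_neg, Measure.restrict_smul]
  rw [pointScaling, pointRate, ← Measure.map_prod_map _ _ (by fun_prop) (by fun_prop), h1, h2,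
    Measure.prod_smul_left, Measure.prod_smul_right, smul_smul,
    ← ENNReal.ofReal_mul (Real.exp_pos _).le, ← Real.exp_add]
  simp

lemma pointScaling_preimage_voidBox (h β y : ℝ) :
    pointScaling h ⁻¹' voidBox β y = voidBox (β + h) y := by
  have e1 : Real.exp (y - β) = Real.exp h * Real.exp (y - (β + h)) := by
    rw [← Real.exp_add]; congr 1; ring
  have e2 : Real.exp (β + h) = Real.exp h * Real.exp β := by
    rw [← Real.exp_add]; congr 1; ring
  have e3 : Real.exp (-h) * Real.exp h = 1 := by rw [← Real.exp_add]; simp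
  have hp := Real.exp_pos h
  have hn := Real.exp_pos (-h)
  ext ⟨x, u⟩
  simp only [pointScaling, voidBox, mem_preimage, Prod.map_apply, mem_prod, mem_Icc, mem_Iic]
  refine and_congr (and_congr (mul_nonneg_iff_of_pos_left hp) ?_) ?_
  · rw [e1, mul_div_assoc, mul_le_mul_iff_right₀ hp]
  · rw [e2, ← mul_le_mul_iff_right₀ hp (b := Real.exp (-h) * u)]
    have l : Real.exp h * (Real.exp (-h) * u) = u := by linear_combination u * e3
    rw [l]
    constructor <;> intro hh <;> linarith

lemma pointRate_voidRegion_shift (h : ℝ) (L : Finset (ℝ × ℝ)) :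
    pointRate (⋃ p ∈ L, voidBox (p.1 + h) p.2) = pointRate (voidRegion L) := by
  rw [← (measurePreserving_pointScaling h).measure_preimage
    (measurableSet_voidRegion L).nullMeasurableSet]
  congr 1
  simp only [voidRegion, preimage_iUnion, pointScaling_preimage_voidBox]

lemma pointRate_voidBox_union (s z : ℝ) (t : ℝ≥0) {U : Set (ℝ × ℝ)}
    (hU : U ⊆ univ ×ˢ Iic (2 * Real.exp s)) :
    pointRate (voidBox (s + t) z ∪ U) = pointRate (voidBox s (z - t) ∪ U) +
      ENNReal.ofReal ((1 - Real.exp (-t)) * Real.exp z) := by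
  set w := Real.exp (z - (s + t)) / 2 with hw
  have hst : Real.exp s ≤ Real.exp (s + t) := Real.exp_le_exp.2 (by simp)
  -- Both boxes have width `e^{z-s-t}/2`, so they differ only by a strip of heights above `2e^s`.
  have hbox : voidBox (s + t) z =
      voidBox s (z - t) ∪ Icc 0 w ×ˢ Ioc (2 * Real.exp s) (2 * Real.exp (s + t)) := by
    rw [voidBox, voidBox, ← hw, show z - t - s = z - (s + t) by ring, ← hw, ← prod_union,
      Iic_union_Ioc_eq_Iic (by linarith)]
  have hsub : voidBox s (z - t) ∪ U ⊆ univ ×ˢ Iic (2 * Real.exp s) :=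
    union_subset (prod_mono_left (subset_univ _)) hU
  have hdisj : Disjoint (voidBox s (z - t) ∪ U)
      (Icc 0 w ×ˢ Ioc (2 * Real.exp s) (2 * Real.exp (s + t))) := by
    refine Disjoint.mono_left hsub ?_
    rw [Set.disjoint_prod]
    right
    rw [Set.disjoint_left]
    intro u hu hu'
    exact absurd hu'.1 (not_lt.2 hu)
  rw [hbox, union_right_comm, measure_union hdisj (measurableSet_Icc.prod measurableSet_Ioc)]
  congr 1
  have hI : Ioc (2 * Real.exp s) (2 * Real.exp (s + t)) ∩ Ici 0 =
      Ioc (2 * Real.exp s) (2 * Real.exp (s + t)) := by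
    refine inter_eq_left.2 fun u hu => ?_
    have := Real.exp_pos s
    simp only [mem_Ici]; linarith [hu.1]
  rw [pointRate, Measure.prod_prod, Measure.restrict_apply measurableSet_Ioc, hI,
    Real.volume_Icc, Real.volume_Ioc, ← ENNReal.ofReal_mul (by rw [hw]; simp; positivity)]
  congr 1
  have e1 : Real.exp (z - (s + t)) * Real.exp (s + t) = Real.exp z := by
    rw [← Real.exp_add]; congr 1; ring
  have e2 : Real.exp (z - (s + t)) * Real.exp s = Real.exp (-t) * Real.exp z := by
    rw [← Real.exp_add, ← Real.exp_add]; congr 1; ring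
  rw [hw]
  linear_combination e1 - e2

/-! ### The Markov process with given void probabilities -/

variable {Ω : Type*} [MeasurableSpace Ω]

/-- The finite-dimensional laws of `X` are given by the void probabilities of a Poisson point
process, and its paths are unit drifts with isolated downward jumps. -/
structure IsVoidProcess (X : ℝ → Ω → ℝ) (P : Measure Ω) : Prop where
  aemeasurable_path : AEMeasurable (fun ω β => X β ω) P
  void : ∀ L : Finset (ℝ × ℝ), P {ω | ∀ p ∈ L, p.2 < X p.1 ω} =
    ENNReal.ofReal (Real.exp (-(pointRate (voidRegion L)).toReal))
  path : ∀ᵐ ω ∂P, IsDriftJumpPath X ω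
  antitone : ∀ᵐ ω ∂P, Antitone fun r => X r ω - r

namespace IsVoidProcess

variable {X : ℝ → Ω → ℝ} {P : Measure Ω}

lemma aemeasurable (hX : IsVoidProcess X P) (β : ℝ) : AEMeasurable (X β) P :=
  (measurable_pi_apply β).comp_aemeasurable hX.aemeasurable_path

lemma aemeasurable_past (hX : IsVoidProcess X P) (s : ℝ) :
    AEMeasurable (fun ω (r : Iic s) => X r ω) P :=
  Measurable.comp_aemeasurable (g := fun (f : ℝ → ℝ) (r : Iic s) => f r) (by fun_prop)
    hX.aemeasurable_path

lemma map_past_upperCylinder (hX : IsVoidProcess X P) (s : ℝ) (L : Finset (Iic s × ℝ)) :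
    P.map (fun ω (r : Iic s) => X r ω) (upperCylinder L) = ENNReal.ofReal
      (Real.exp (-(pointRate (⋃ p ∈ L, voidBox p.1 p.2)).toReal)) := by
  classical
  rw [Measure.map_apply_of_aemeasurable (hX.aemeasurable_past s) (measurableSet_upperCylinder L)]
  have h := hX.void (L.image fun p => ((p.1 : ℝ), p.2))
  have hv : voidRegion (L.image fun p => ((p.1 : ℝ), p.2)) = ⋃ p ∈ L, voidBox p.1 p.2 := by
    rw [voidRegion, Finset.set_biUnion_finset_image]
  rw [hv] at h
  rw [← h]
  congr 1
  ext ω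
  simp only [upperCylinder, mem_preimage, mem_ofPred_eq, Finset.forall_mem_image]

variable [IsProbabilityMeasure P]

lemma isStationary (hX : IsVoidProcess X P) : IsStationary X P := by
  classical
  intro h
  have hm : AEMeasurable (fun ω t => X (t + h) ω) P :=
    Measurable.comp_aemeasurable (g := fun (f : ℝ → ℝ) t => f (t + h)) (by fun_prop)
      hX.aemeasurable_path
  refine ⟨hm, hX.aemeasurable_path, ?_⟩
  have := Measure.isProbabilityMeasure_map (μ := P) hm
  have := Measure.isProbabilityMeasure_map (μ := P) hX.aemeasurable_path
  refine ext_of_generate_finite _ (generateFrom_upperCylinder ℝ).symm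
    (isPiSystem_upperCylinder ℝ) ?_ (by simp)
  rintro _ ⟨L, rfl⟩
  rw [Measure.map_apply_of_aemeasurable hm (measurableSet_upperCylinder L),
    Measure.map_apply_of_aemeasurable hX.aemeasurable_path (measurableSet_upperCylinder L)]
  have h1 := hX.void (L.image fun p => (p.1 + h, p.2))
  have h2 := hX.void L
  have h3 : voidRegion (L.image fun p => (p.1 + h, p.2)) = ⋃ p ∈ L, voidBox (p.1 + h) p.2 := by
    rw [voidRegion, Finset.set_biUnion_finset_image]
  rw [h3, pointRate_voidRegion_shift, ← h2] at h1
  rw [show (fun ω β => X β ω) ⁻¹' upperCylinder L = {ω | ∀ p ∈ L, p.2 < X p.1 ω} from rfl, ← h1]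
  congr 1
  ext ω
  simp only [upperCylinder, mem_preimage, mem_ofPred_eq, Finset.forall_mem_image]

lemma hasLaw (hX : IsVoidProcess X P) (β : ℝ) : HasLaw (X β) negGumbel P := by
  refine ⟨hX.aemeasurable β, ?_⟩
  have := Measure.isProbabilityMeasure_map (μ := P) (hX.aemeasurable β)
  refine ext_of_Ioi fun y => ?_
  rw [Measure.map_apply_of_aemeasurable (hX.aemeasurable β) measurableSet_Ioi, negGumbel_Ioi]
  have h := hX.void {(β, y)}
  have hv : voidRegion {(β, y)} = voidBox β y := by simp [voidRegion]
  rw [hv, pointRate_voidBox, ENNReal.toReal_ofReal (Real.exp_pos y).le] at h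
  rw [← h]
  congr 1
  ext ω; simp

/-- The joint law of the past and of a future value. -/
theorem map_past_future (hX : IsVoidProcess X P) (s : ℝ) (t : ℝ≥0) :
    P.map (fun ω => (fun r : Iic s => X r ω, X (s + t) ω)) =
      (P.map (fun ω (r : Iic s) => X r ω)) ⊗ₘ
        ((transitionKernel t).comap (fun f : Iic s → ℝ => f ⟨s, mem_Iic.2 le_rfl⟩)
          (measurable_pi_apply _)) := by
  classical
  have hm : AEMeasurable (fun ω => (fun r : Iic s => X r ω, X (s + t) ω)) P :=
    (hX.aemeasurable_past s).prodMk (hX.aemeasurable _)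
  have := Measure.isProbabilityMeasure_map (μ := P) hm
  have := Measure.isProbabilityMeasure_map (μ := P) (hX.aemeasurable_past s)
  refine ext_of_generate_finite _ (generateFrom_eq_prod (generateFrom_upperCylinder (Iic s))
    (BorelSpace.measurable_eq.trans (borel_eq_generateFrom_Ioi ℝ)).symm
    (isCountablySpanning_upperCylinder _) isCountablySpanning_Ioi).symm
    ((isPiSystem_upperCylinder _).prod isPiSystem_Ioi) ?_ (by simp)
  rintro _ ⟨_, ⟨L, rfl⟩, _, ⟨z, rfl⟩, rfl⟩
  have hL := measurableSet_upperCylinder L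
  rw [Measure.map_apply_of_aemeasurable hm (hL.prod measurableSet_Ioi),
    Measure.compProd_apply_prod hL measurableSet_Ioi]
  set U : Set (ℝ × ℝ) := ⋃ p ∈ L, voidBox p.1 p.2 with hUdef
  have hU : U ⊆ univ ×ˢ Iic (2 * Real.exp s) := by
    refine iUnion₂_subset fun p _ => prod_mono (subset_univ _) (Iic_subset_Iic.2 ?_)
    have := Real.exp_le_exp.2 p.1.2
    linarith
  have hlhs : P ((fun ω => (fun r : Iic s => X r ω, X (s + t) ω)) ⁻¹'
      upperCylinder L ×ˢ Ioi z) =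
      ENNReal.ofReal (Real.exp (-(pointRate (voidBox (s + t) z ∪ U)).toReal)) := by
    have h := hX.void (insert (s + t, z) (L.image fun p => ((p.1 : ℝ), p.2)))
    have hv : voidRegion (insert (s + (t : ℝ), z) (L.image fun p => ((p.1 : ℝ), p.2))) =
        voidBox (s + t) z ∪ U := by
      rw [voidRegion, Finset.set_biUnion_insert, Finset.set_biUnion_finset_image]
    rw [hv] at h
    rw [← h]
    congr 1
    ext ω
    simp only [upperCylinder, mem_preimage, mem_ofPred_eq, Finset.forall_mem_insert,
      Finset.forall_mem_image, mem_prod, mem_Ioi]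
    exact and_comm
  have hrhs : ∫⁻ f in upperCylinder L, ((transitionKernel t).comap
        (fun f : Iic s → ℝ => f ⟨s, mem_Iic.2 le_rfl⟩) (measurable_pi_apply _)) f (Ioi z)
        ∂(P.map (fun ω (r : Iic s) => X r ω)) =
      ENNReal.ofReal (Real.exp (-((1 - Real.exp (-t)) * Real.exp z))) *
        ENNReal.ofReal (Real.exp (-(pointRate (voidBox s (z - t) ∪ U)).toReal)) := by
    -- By the tail formula the kernel is a constant times the indicator of `X s > z - t`; this
    -- indicator is one more constraint on the past, so the integral is again a void probability.
    have h := hX.map_past_upperCylinder s (insert (⟨s, mem_Iic.2 le_rfl⟩, z - t) L)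
    have hv : (⋃ p ∈ insert ((⟨s, mem_Iic.2 le_rfl⟩ : Iic s), z - t) L, voidBox p.1 p.2) =
        voidBox s (z - t) ∪ U := by rw [Finset.set_biUnion_insert]
    rw [hv] at h
    have hset : upperCylinder (insert ((⟨s, mem_Iic.2 le_rfl⟩ : Iic s), z - t) L) =
        (fun f : Iic s → ℝ => f ⟨s, mem_Iic.2 le_rfl⟩) ⁻¹' Ioi (z - t) ∩ upperCylinder L := by
      ext f; simp [upperCylinder]
    have hms : MeasurableSet ((fun f : Iic s → ℝ => f ⟨s, mem_Iic.2 le_rfl⟩) ⁻¹' Ioi (z - t)) :=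
      measurableSet_Ioi.preimage (measurable_pi_apply _)
    rw [← h, hset]
    simp only [Kernel.comap_apply, transitionKernel_apply, transitionLaw_Ioi]
    rw [← Measure.restrict_apply hms, ← lintegral_indicator_const hms]
    rfl
  have hfin : pointRate (voidBox s (z - t) ∪ U) ≠ ∞ := by
    refine (measure_union_lt_top (by rw [pointRate_voidBox]; exact ENNReal.ofReal_lt_top) ?_).ne
    refine (measure_biUnion_finset_le L _).trans_lt (ENNReal.sum_lt_top.2 fun p _ => ?_)
    rw [pointRate_voidBox]
    exact ENNReal.ofReal_lt_top
  have h1 : 0 ≤ (1 - Real.exp (-(t : ℝ))) * Real.exp z :=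
    mul_nonneg (by simp) (Real.exp_pos z).le
  rw [hlhs, hrhs, pointRate_voidBox_union s z t hU, ENNReal.toReal_add hfin ENNReal.ofReal_ne_top,
    ENNReal.toReal_ofReal h1, ← ENNReal.ofReal_mul (Real.exp_pos _).le, ← Real.exp_add, neg_add,
    add_comm]

lemma isMarkovProcess (hX : IsVoidProcess X P) : IsMarkovProcess X transitionKernel P := by
  intro s t A B hA hB
  have hm : AEMeasurable (fun ω => (fun r : Iic s => X r ω, X (s + t) ω)) P :=
    (hX.aemeasurable_past s).prodMk (hX.aemeasurable _)
  have := Measure.isProbabilityMeasure_map (μ := P) (hX.aemeasurable_past s)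
  have h := congrArg (fun μ : Measure _ => μ (A ×ˢ B)) (hX.map_past_future s t)
  rw [Measure.map_apply_of_aemeasurable hm (hA.prod hB), Measure.compProd_apply_prod hA hB,
    Measure.restrict_map_of_aemeasurable (hX.aemeasurable_past s) hA, lintegral_map'] at h
  · exact h
  · exact (Kernel.measurable_coe _ hB).aemeasurable
  · exact (hX.aemeasurable_past s).restrict

end IsVoidProcess

end BrownianInterlacement

namespace BrownianInterlacement

/-! ### The stochastic intensity of the jumps -/

/-- The atom at `y + h` corresponds to the drop `0`, excluded from `A`. -/
lemma transitionLaw_drop (h : ℝ≥0) (y : ℝ) {A : Set ℝ} (hA : MeasurableSet A) (h0 : 0 ∉ A) :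
    transitionLaw h y {z | y + h - z ∈ A} = jumpLaw (jumpIntensity h y) A := by
  have hm : MeasurableSet {z : ℝ | y + h - z ∈ A} :=
    hA.preimage (f := fun z => y + h - z) (by fun_prop)
  rw [transitionLaw, Measure.add_apply, Measure.smul_apply, Measure.dirac_apply' _ hm,
    indicator_of_notMem (by simpa using h0), smul_zero, zero_add,
    Measure.map_apply (by fun_prop) hm]
  congr 1
  ext v
  simp

lemma measurable_jumpLaw_jumpIntensity (h : ℝ≥0) {A : Set ℝ} (hA : MeasurableSet A)
    (h0 : 0 ∉ A) : Measurable fun y => jumpLaw (jumpIntensity h y) A := by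
  have hS : MeasurableSet {p : ℝ × ℝ | p.1 + h - p.2 ∈ A} :=
    hA.preimage (f := fun p : ℝ × ℝ => p.1 + h - p.2) (by fun_prop)
  have := Kernel.measurable_kernel_prodMk_left (κ := transitionKernel h) hS
  simpa only [transitionKernel_apply, preimage_ofPred_eq, transitionLaw_drop h _ hA h0] using this

lemma jumpLaw_le {c : ℝ} (hc : 0 ≤ c) {A : Set ℝ} (hA : MeasurableSet A) :
    jumpLaw c A ≤ ENNReal.ofReal c * expMeasure 1 A := by
  rw [jumpLaw, withDensity_apply _ hA, ← setLIntegral_const]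
  refine lintegral_mono fun v => ENNReal.ofReal_le_ofReal ?_
  exact mul_le_of_le_one_right hc (Real.exp_le_one_iff.2 (by simp; positivity))

/-- For `v ≥ 0` the weight `exp (-c e^{-v})` lies between `e^{-c}` and `1`. Together with
`jumpLaw_le` this pins the law of the drop to `c • Exp(1)` as `c → 0`. -/
lemma le_jumpLaw {c : ℝ} (hc : 0 ≤ c) {A : Set ℝ} (hA : MeasurableSet A) :
    ENNReal.ofReal (c * Real.exp (-c)) * expMeasure 1 A ≤ jumpLaw c A := by
  have hr : (expMeasure 1).restrict A ≪ (volume : Measure ℝ).restrict (Ioi 0) := by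
    refine Measure.restrict_le_self.absolutelyContinuous.trans ?_
    rw [expMeasure_one_eq]
    exact withDensity_absolutelyContinuous _ _
  rw [jumpLaw, withDensity_apply _ hA, ← setLIntegral_const]
  refine lintegral_mono_ae ?_
  filter_upwards [hr.ae_le (ae_restrict_mem measurableSet_Ioi)] with v hv
  refine ENNReal.ofReal_le_ofReal (mul_le_mul_of_nonneg_left ?_ hc)
  rw [Real.exp_le_exp, neg_le_neg_iff]
  exact mul_le_of_le_one_right hc (Real.exp_le_one_iff.2 (by simpa using hv.le))

lemma le_exp_sub_one (h : ℝ) : h ≤ Real.exp h - 1 := by linarith [Real.add_one_le_exp h]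

lemma exp_sub_one_le_mul_exp (h : ℝ) : Real.exp h - 1 ≤ Real.exp h * h := by
  have h1 := Real.add_one_le_exp (-h)
  have h2 : Real.exp h * Real.exp (-h) = 1 := by rw [← Real.exp_add]; simp
  nlinarith [mul_le_mul_of_nonneg_left h1 (Real.exp_pos h).le]

/-- The length of the intervals of the subdivision of `[s, t]` into `n + 1` intervals. -/
def mesh (s t : ℝ) (n : ℕ) : ℝ≥0 := ((t - s) / (n + 1)).toNNReal

lemma coe_mesh {s t : ℝ} (hst : s ≤ t) (n : ℕ) : (mesh s t n : ℝ) = (t - s) / (n + 1) :=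
  Real.coe_toNNReal _ (div_nonneg (by linarith) (by positivity))

lemma mesh_le {s t : ℝ} (hst : s ≤ t) (n : ℕ) : (mesh s t n : ℝ) ≤ t - s := by
  rw [coe_mesh hst]
  exact div_le_self (by linarith) (by linarith [n.cast_nonneg (α := ℝ)])

lemma sum_jumpLaw_le {x : ℝ → ℝ} {s t : ℝ} (hst : s ≤ t) {A : Set ℝ} (hA : MeasurableSet A)
    (n : ℕ) :
    ∑ i ∈ Finset.range (n + 1), jumpLaw (jumpIntensity (mesh s t n) (x (gridPoint s t n i))) A ≤
      ENNReal.ofReal (Real.exp ((t - s) / (n + 1)) * ((t - s) / (n + 1) *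
        ∑ i ∈ Finset.range (n + 1), Real.exp (x (gridPoint s t n i)))) * expMeasure 1 A := by
  have hh : 0 ≤ (t - s) / ((n : ℝ) + 1) := div_nonneg (by linarith) (by positivity)
  rw [Finset.mul_sum, Finset.mul_sum, ENNReal.ofReal_sum_of_nonneg (fun i _ => by positivity),
    Finset.sum_mul]
  refine Finset.sum_le_sum fun i _ => (jumpLaw_le (jumpIntensity_nonneg _ _) hA).trans ?_
  refine mul_le_mul' (ENNReal.ofReal_le_ofReal ?_) le_rfl
  rw [jumpIntensity, coe_mesh hst, ← mul_assoc]
  exact mul_le_mul_of_nonneg_right (exp_sub_one_le_mul_exp _) (Real.exp_pos _).le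

lemma gridPoint_value_le {x : ℝ → ℝ} (hx : Antitone fun r => x r - r) {s t : ℝ} (hst : s ≤ t)
    {n i : ℕ} (hi : i ≤ n + 1) : x (gridPoint s t n i) ≤ x s + (t - s) := by
  have h1 := hx (le_gridPoint hst n i)
  have h2 := gridPoint_le hst hi
  simp only at h1
  linarith

/-- The correction factors `e^{-c}` vary with the cell; the bound `x ≤ x s + (t - s)` at all grid
points replaces them by one factor, which tends to `1` with the mesh. -/
lemma le_sum_jumpLaw {x : ℝ → ℝ} (hx : Antitone fun r => x r - r) {s t : ℝ} (hst : s ≤ t)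
    {A : Set ℝ} (hA : MeasurableSet A) (n : ℕ) :
    ENNReal.ofReal (Real.exp (-((Real.exp ((t - s) / (n + 1)) - 1) * Real.exp (x s + (t - s)))) *
      ((t - s) / (n + 1) * ∑ i ∈ Finset.range (n + 1), Real.exp (x (gridPoint s t n i)))) *
        expMeasure 1 A ≤
    ∑ i ∈ Finset.range (n + 1),
      jumpLaw (jumpIntensity (mesh s t n) (x (gridPoint s t n i))) A := by
  have hh : 0 ≤ (t - s) / ((n : ℝ) + 1) := div_nonneg (by linarith) (by positivity)
  rw [Finset.mul_sum, Finset.mul_sum, ENNReal.ofReal_sum_of_nonneg (fun i _ => by positivity),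
    Finset.sum_mul]
  refine Finset.sum_le_sum fun i hi => le_trans ?_ (le_jumpLaw (jumpIntensity_nonneg _ _) hA)
  refine mul_le_mul' (ENNReal.ofReal_le_ofReal ?_) le_rfl
  rw [jumpIntensity, coe_mesh hst]
  refine (mul_comm _ _).trans_le ?_
  refine mul_le_mul ?_ (Real.exp_le_exp.2 (neg_le_neg ?_)) (Real.exp_pos _).le ?_
  · exact mul_le_mul_of_nonneg_right (le_exp_sub_one _) (Real.exp_pos _).le
  · refine mul_le_mul_of_nonneg_left (Real.exp_le_exp.2 (gridPoint_value_le hx hst ?_)) ?_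
    · exact (Finset.mem_range.1 hi).le
    · linarith [le_exp_sub_one ((t - s) / ((n : ℝ) + 1))]
  · exact mul_nonneg (by linarith [le_exp_sub_one ((t - s) / ((n : ℝ) + 1))]) (Real.exp_pos _).le

lemma tendsto_sum_jumpLaw {x : ℝ → ℝ} (hx : Antitone fun r => x r - r) {s t : ℝ} (hst : s ≤ t)
    {A : Set ℝ} (hA : MeasurableSet A) :
    Tendsto (fun n => ∑ i ∈ Finset.range (n + 1),
        jumpLaw (jumpIntensity (mesh s t n) (x (gridPoint s t n i))) A) atTop
      (𝓝 (expMeasure 1 A * ∫⁻ r in Ioc s t, ENNReal.ofReal (Real.exp (x r)))) := by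
  have hI : ∫⁻ r in Ioc s t, ENNReal.ofReal (Real.exp (x r)) =
      ENNReal.ofReal (∫ r in s..t, Real.exp (x r)) := by
    rw [intervalIntegral.integral_of_le hst, ofReal_integral_eq_lintegral_ofReal
      ((intervalIntegrable_iff_integrableOn_Ioc_of_le hst).1
        (intervalIntegrable_exp_of_antitone hx s t)) (ae_of_all _ fun r => (Real.exp_pos _).le)]
  have hS := tendsto_riemannSum_exp hx hst
  have hm := tendsto_mesh s t
  have he : Tendsto (fun n : ℕ => Real.exp ((t - s) / (n + 1))) atTop (𝓝 1) := by
    simpa [Function.comp_def] using (Real.continuous_exp.tendsto _).comp hm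
  have he' : Tendsto (fun n : ℕ => Real.exp (-((Real.exp ((t - s) / (n + 1)) - 1) *
      Real.exp (x s + (t - s))))) atTop (𝓝 1) := by
    have := ((he.sub_const 1).mul_const (Real.exp (x s + (t - s)))).neg
    simpa [Function.comp_def] using (Real.continuous_exp.tendsto _).comp this
  rw [hI, mul_comm]
  refine tendsto_of_tendsto_of_tendsto_of_le_of_le ?_ ?_ (le_sum_jumpLaw hx hst hA)
    (sum_jumpLaw_le hst hA)
  · refine ENNReal.Tendsto.mul_const (ENNReal.tendsto_ofReal ?_) (Or.inr (measure_ne_top _ _))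
    simpa using he'.mul hS
  · refine ENNReal.Tendsto.mul_const (ENNReal.tendsto_ofReal ?_) (Or.inr (measure_ne_top _ _))
    simpa using he.mul hS

variable {Ω : Type*} [MeasurableSpace Ω]

namespace IsVoidProcess

variable {X : ℝ → Ω → ℝ} {P : Measure Ω}

lemma aemeasurable_gridDrop (hX : IsVoidProcess X P) (s t : ℝ) (n i : ℕ) :
    AEMeasurable (gridDrop X s t n i) P :=
  ((hX.aemeasurable _).add_const _).sub (hX.aemeasurable _)

lemma aemeasurable_sum_indicator_gridDrop (hX : IsVoidProcess X P) (s t : ℝ) (n : ℕ) {A : Set ℝ}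
    (hA : MeasurableSet A) : AEMeasurable (fun ω => ∑ i ∈ Finset.range (n + 1),
      A.indicator (1 : ℝ → ℝ≥0∞) (gridDrop X s t n i ω)) P :=
  Finset.aemeasurable_fun_sum _ fun i _ =>
    (measurable_one.indicator hA).comp_aemeasurable (hX.aemeasurable_gridDrop s t n i)

lemma aemeasurable_jumpCount (hX : IsVoidProcess X P) (s t : ℝ) {A : Set ℝ}
    (hA : MeasurableSet A) : AEMeasurable (jumpCount X s t A) P := by
  rcases le_or_gt s t with hst | hst
  · have hA' := hA.diff (measurableSet_singleton 0)
    have : jumpCount X s t A = jumpCount X s t (A \ {0}) :=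
      funext fun ω => (jumpCount_diff_zero s t A).symm
    rw [this]
    refine aemeasurable_of_tendsto_metrizable_ae atTop
      (fun n => hX.aemeasurable_sum_indicator_gridDrop s t n hA') ?_
    filter_upwards [hX.path] with ω hω
    exact hω.tendsto_sum_indicator_gridDrop hst (by simp)
  · have : jumpCount X s t A = 0 := by
      funext ω; simp [jumpCount, jumpTimes, Ioc_eq_empty_of_le hst.le]
    rw [this]
    exact aemeasurable_zero

variable [IsProbabilityMeasure P]

/-- Under the negative Gumbel law `e^{X s}` has tail `e^{-r}`, so it is a standard exponential
variable of mean `1`. -/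
lemma lintegral_exp (hX : IsVoidProcess X P) (s : ℝ) :
    ∫⁻ ω, ENNReal.ofReal (Real.exp (X s ω)) ∂P = 1 := by
  rw [lintegral_eq_lintegral_meas_lt P (ae_of_all _ fun ω => (Real.exp_pos _).le)
    (Real.measurable_exp.comp_aemeasurable (hX.aemeasurable s))]
  have : ∫⁻ r in Ioi (0 : ℝ), P {ω | r < Real.exp (X s ω)} =
      ∫⁻ r in Ioi (0 : ℝ), ENNReal.ofReal (Real.exp (-r)) := by
    refine setLIntegral_congr_fun measurableSet_Ioi fun r hr => ?_
    have hset : {ω | r < Real.exp (X s ω)} = {ω | Real.log r < X s ω} := by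
      ext ω; simp only [mem_ofPred_eq, Real.log_lt_iff_lt_exp hr]
    rw [hset, (hX.hasLaw s).measure_eq measurableSet_Ioi]
    exact (negGumbel_Ioi _).trans (by rw [Real.exp_log hr])
  rw [this, ← ofReal_integral_eq_lintegral_ofReal (integrableOn_exp_neg_Ioi 0)
    (ae_of_all _ fun r => (Real.exp_pos _).le), integral_exp_neg_Ioi]
  simp

lemma lintegral_exp_drift_lt_top (hX : IsVoidProcess X P) (s c : ℝ) :
    ∫⁻ ω, ENNReal.ofReal (c * Real.exp (X s ω)) ∂P < ∞ := by
  rcases le_or_gt 0 c with hc | hc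
  · simp_rw [ENNReal.ofReal_mul hc]
    rw [lintegral_const_mul' _ _ ENNReal.ofReal_ne_top, hX.lintegral_exp, mul_one]
    exact ENNReal.ofReal_lt_top
  · have : ∀ ω, ENNReal.ofReal (c * Real.exp (X s ω)) = 0 := fun ω =>
      ENNReal.ofReal_of_nonpos (mul_nonpos_of_nonpos_of_nonneg hc.le (Real.exp_pos _).le)
    simp [this]

lemma finite_intensity (hX : IsVoidProcess X P) (s t : ℝ) :
    ∫⁻ ω, (∫⁻ r in Ioc s t, ENNReal.ofReal (Real.exp (X r ω))) ∂P < ∞ := by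
  rcases le_or_gt s t with hst | hst
  · refine lt_of_le_of_lt ?_ (hX.lintegral_exp_drift_lt_top s ((t - s) * Real.exp (t - s)))
    refine lintegral_mono_ae ?_
    filter_upwards [hX.antitone] with ω hω
    have hle : ∀ r ∈ Ioc s t, ENNReal.ofReal (Real.exp (X r ω)) ≤
        ENNReal.ofReal (Real.exp (t - s) * Real.exp (X s ω)) := by
      intro r hr
      refine ENNReal.ofReal_le_ofReal ?_
      rw [← Real.exp_add, Real.exp_le_exp]
      have := hω hr.1.le
      simp only at this
      linarith [hr.2]
    refine (setLIntegral_mono measurable_const hle).trans ?_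
    rw [setLIntegral_const, Real.volume_Ioc, ← ENNReal.ofReal_mul (by positivity)]
    exact ENNReal.ofReal_le_ofReal (by linarith)
  · simp [Ioc_eq_empty_of_le hst.le]

/-- The event couples `X r` and `X (r + h)`, so it is no rectangle; it is evaluated under the full
joint law `map_past_future` at time `r`, with the event of the past up to `s` viewed as one of the
past up to `r`. -/
lemma measure_past_inter_drop (hX : IsVoidProcess X P) {s r : ℝ} (hsr : s ≤ r) (h : ℝ≥0)
    {F : Set (Iic s → ℝ)} {A : Set ℝ} (hF : MeasurableSet F) (hA : MeasurableSet A)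
    (h0 : 0 ∉ A) :
    P (pastEvent X s F ∩ {ω | X r ω + h - X (r + h) ω ∈ A}) =
      ∫⁻ ω in pastEvent X s F, jumpLaw (jumpIntensity h (X r ω)) A ∂P := by
  set G : Set (Iic r → ℝ) := {f | (fun q : Iic s => f ⟨q, (mem_Iic.1 q.2).trans hsr⟩) ∈ F}
  have hG : MeasurableSet G :=
    hF.preimage (f := fun (f : Iic r → ℝ) (q : Iic s) => f ⟨q, (mem_Iic.1 q.2).trans hsr⟩)
      (measurable_pi_lambda _ fun q => measurable_pi_apply _)
  have hev : Measurable fun f : Iic r → ℝ => f ⟨r, mem_Iic.2 le_rfl⟩ := measurable_pi_apply _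
  set D : Set ((Iic r → ℝ) × ℝ) := {p | p.1 ⟨r, mem_Iic.2 le_rfl⟩ + h - p.2 ∈ A}
  have hD : MeasurableSet D :=
    hA.preimage (f := fun p : (Iic r → ℝ) × ℝ => p.1 ⟨r, mem_Iic.2 le_rfl⟩ + h - p.2)
      (((hev.comp measurable_fst).add_const _).sub measurable_snd)
  have hm : AEMeasurable (fun ω => (fun q : Iic r => X q ω, X (r + h) ω)) P :=
    (hX.aemeasurable_past r).prodMk (hX.aemeasurable _)
  have := Measure.isProbabilityMeasure_map (μ := P) (hX.aemeasurable_past r)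
  have hmeas := measurable_jumpLaw_jumpIntensity h hA h0
  have hGD : MeasurableSet (Prod.fst ⁻¹' G ∩ D) := (hG.preimage measurable_fst).inter hD
  have key := congrArg (fun μ : Measure _ => μ (Prod.fst ⁻¹' G ∩ D)) (hX.map_past_future r h)
  rw [Measure.map_apply_of_aemeasurable hm hGD, Measure.compProd_apply hGD] at key
  have hsec : ∀ f : Iic r → ℝ, (transitionKernel h).comap
      (fun f : Iic r → ℝ => f ⟨r, mem_Iic.2 le_rfl⟩) (measurable_pi_apply _) f
        (Prod.mk f ⁻¹' (Prod.fst ⁻¹' G ∩ D)) =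
      G.indicator (fun f => jumpLaw (jumpIntensity h (f ⟨r, mem_Iic.2 le_rfl⟩)) A) f := by
    intro f
    rw [Kernel.comap_apply, transitionKernel_apply]
    by_cases hf : f ∈ G
    · rw [indicator_of_mem hf, ← transitionLaw_drop h _ hA h0]
      congr 1
      ext z
      simp [D, hf]
    · have : Prod.mk f ⁻¹' (Prod.fst ⁻¹' G ∩ D) = ∅ := by
        ext z; simp [hf]
      rw [this, indicator_of_notMem hf, measure_empty]
  rw [lintegral_congr hsec, lintegral_indicator hG,
    Measure.restrict_map_of_aemeasurable (hX.aemeasurable_past r) hG,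
    lintegral_map'
      (f := fun f : Iic r → ℝ => jumpLaw (jumpIntensity h (f ⟨r, mem_Iic.2 le_rfl⟩)) A)
      (hmeas.comp hev).aemeasurable (hX.aemeasurable_past r).restrict] at key
  exact key

lemma lintegral_sum_indicator_gridDrop (hX : IsVoidProcess X P) {s t : ℝ} (hst : s ≤ t)
    {F : Set (Iic s → ℝ)} {A : Set ℝ} (hF : MeasurableSet F) (hA : MeasurableSet A)
    (h0 : 0 ∉ A) (n : ℕ) :
    ∫⁻ ω in pastEvent X s F, (∑ i ∈ Finset.range (n + 1),
        A.indicator (1 : ℝ → ℝ≥0∞) (gridDrop X s t n i ω)) ∂P =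
      ∫⁻ ω in pastEvent X s F, (∑ i ∈ Finset.range (n + 1),
        jumpLaw (jumpIntensity (mesh s t n) (X (gridPoint s t n i) ω)) A) ∂P := by
  have hm₁ : ∀ i, AEMeasurable (fun ω => A.indicator (1 : ℝ → ℝ≥0∞) (gridDrop X s t n i ω))
      (P.restrict (pastEvent X s F)) := fun i =>
    ((measurable_one.indicator hA).comp_aemeasurable
      (hX.aemeasurable_gridDrop s t n i)).restrict
  have hm₂ : ∀ i, AEMeasurable
      (fun ω => jumpLaw (jumpIntensity (mesh s t n) (X (gridPoint s t n i) ω)) A)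
      (P.restrict (pastEvent X s F)) := fun i =>
    ((measurable_jumpLaw_jumpIntensity _ hA h0).comp_aemeasurable (hX.aemeasurable _)).restrict
  rw [lintegral_finsetSum' _ fun i _ => hm₁ i, lintegral_finsetSum' _ fun i _ => hm₂ i]
  refine Finset.sum_congr rfl fun i _ => ?_
  rw [← hX.measure_past_inter_drop (le_gridPoint hst n i) _ hF hA h0, coe_mesh hst,
    ← gridPoint_succ]
  have hset : {ω | X (gridPoint s t n i) ω + (t - s) / (n + 1) -
      X (gridPoint s t n (i + 1)) ω ∈ A} = gridDrop X s t n i ⁻¹' A := rfl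
  have hnull : NullMeasurableSet (gridDrop X s t n i ⁻¹' A) (P.restrict (pastEvent X s F)) :=
    ((hX.aemeasurable_gridDrop s t n i).nullMeasurableSet_preimage hA).mono_ac
      Measure.restrict_le_self.absolutelyContinuous
  have hind : (fun ω => A.indicator (1 : ℝ → ℝ≥0∞) (gridDrop X s t n i ω)) =
      (gridDrop X s t n i ⁻¹' A).indicator 1 := rfl
  rw [hset, hind, lintegral_indicator_one₀ hnull,
    Measure.restrict_apply₀ hnull, inter_comm]

lemma tendsto_lintegral_sum_jumpLaw (hX : IsVoidProcess X P) {s t : ℝ} (hst : s ≤ t)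
    (F : Set (Iic s → ℝ)) {A : Set ℝ} (hA : MeasurableSet A) (h0 : 0 ∉ A) :
    Tendsto (fun n => ∫⁻ ω in pastEvent X s F, (∑ i ∈ Finset.range (n + 1),
        jumpLaw (jumpIntensity (mesh s t n) (X (gridPoint s t n i) ω)) A) ∂P) atTop
      (𝓝 (expMeasure 1 A * ∫⁻ ω in pastEvent X s F,
        (∫⁻ r in Ioc s t, ENNReal.ofReal (Real.exp (X r ω))) ∂P)) := by
  have hm : ∀ n i, AEMeasurable
      (fun ω => jumpLaw (jumpIntensity (mesh s t n) (X (gridPoint s t n i) ω)) A)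
      (P.restrict (pastEvent X s F)) := fun n i =>
    ((measurable_jumpLaw_jumpIntensity _ hA h0).comp_aemeasurable (hX.aemeasurable _)).restrict
  rw [← lintegral_const_mul' _ _ (measure_ne_top _ _)]
  -- In the bound, one factor `e^{t-s}` dominates `e^h` for the mesh `h`, and `(t - s) e^{t-s} e^{X
  -- s}` dominates the Riemann sum because the path rises by at most `t - s`.
  refine tendsto_lintegral_of_dominated_convergence'
    (fun ω => ENNReal.ofReal
      (Real.exp (t - s) * ((t - s) * Real.exp (t - s)) * Real.exp (X s ω))) ?_ ?_ ?_ ?_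
  · exact fun n => Finset.aemeasurable_fun_sum _ fun i _ => hm n i
  · intro n
    filter_upwards [ae_restrict_of_ae hX.antitone] with ω hω
    refine (sum_jumpLaw_le (x := fun r => X r ω) hst hA n).trans
      ((mul_le_of_le_one_right zero_le prob_le_one).trans ?_)
    refine ENNReal.ofReal_le_ofReal ?_
    have hts : 0 ≤ t - s := by linarith
    have hh : 0 ≤ (t - s) / ((n : ℝ) + 1) := div_nonneg hts (by positivity)
    have hsum : ∑ i ∈ Finset.range (n + 1), Real.exp (X (gridPoint s t n i) ω) ≤
        (n + 1) * Real.exp (X s ω + (t - s)) := by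
      have := Finset.sum_le_card_nsmul (Finset.range (n + 1))
        (fun i => Real.exp (X (gridPoint s t n i) ω)) (Real.exp (X s ω + (t - s))) fun i hi =>
          Real.exp_le_exp.2 (gridPoint_value_le (x := fun r => X r ω) hω hst (Finset.mem_range.1 hi).le)
      simpa using this
    have h1 : Real.exp ((t - s) / ((n : ℝ) + 1)) ≤ Real.exp (t - s) :=
      Real.exp_le_exp.2 (coe_mesh hst n ▸ mesh_le hst n)
    calc Real.exp ((t - s) / (n + 1)) * ((t - s) / (n + 1) *
          ∑ i ∈ Finset.range (n + 1), Real.exp (X (gridPoint s t n i) ω))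
        ≤ Real.exp (t - s) * ((t - s) / (n + 1) * ((n + 1) * Real.exp (X s ω + (t - s)))) := by
          gcongr
      _ = Real.exp (t - s) * ((t - s) * Real.exp (t - s)) * Real.exp (X s ω) := by
          rw [Real.exp_add]; field_simp
  · exact ((setLIntegral_le_lintegral _ _).trans_lt (hX.lintegral_exp_drift_lt_top s _)).ne
  · filter_upwards [ae_restrict_of_ae hX.antitone] with ω hω
    exact tendsto_sum_jumpLaw (x := fun r => X r ω) hω hst hA

/-- Fatou's lemma for the grid counts suffices here. The total jump count can then dominate in the
proof of `intensity` without circularity. -/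
lemma lintegral_jumpCount_univ_lt_top (hX : IsVoidProcess X P) {s t : ℝ} (hst : s ≤ t)
    {F : Set (Iic s → ℝ)} (hF : MeasurableSet F) :
    ∫⁻ ω in pastEvent X s F, jumpCount X s t univ ω ∂P < ∞ := by
  have hA : MeasurableSet ({0}ᶜ : Set ℝ) := (measurableSet_singleton 0).compl
  have h0 : (0 : ℝ) ∉ ({0}ᶜ : Set ℝ) := by simp
  have hlim := hX.tendsto_lintegral_sum_jumpLaw hst F hA h0
  simp_rw [← hX.lintegral_sum_indicator_gridDrop hst hF hA h0] at hlim
  have hcongr : ∫⁻ ω in pastEvent X s F, jumpCount X s t univ ω ∂P =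
      ∫⁻ ω in pastEvent X s F, liminf (fun n => ∑ i ∈ Finset.range (n + 1),
        ({0}ᶜ : Set ℝ).indicator (1 : ℝ → ℝ≥0∞) (gridDrop X s t n i ω)) atTop ∂P := by
    refine lintegral_congr_ae (ae_restrict_of_ae ?_)
    filter_upwards [hX.path] with ω hω
    rw [(hω.tendsto_sum_indicator_gridDrop hst h0).liminf_eq, compl_eq_univ_sdiff,
      jumpCount_diff_zero]
  rw [hcongr]
  refine (lintegral_liminf_le' fun n =>
    (hX.aemeasurable_sum_indicator_gridDrop s t n hA).restrict).trans_lt ?_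
  rw [hlim.liminf_eq]
  exact ENNReal.mul_lt_top (measure_lt_top _ _)
    ((setLIntegral_le_lintegral _ _).trans_lt (hX.finite_intensity s t))

lemma intensity (hX : IsVoidProcess X P) {s t : ℝ} (hst : s ≤ t) {F : Set (Iic s → ℝ)}
    {A : Set ℝ} (hF : MeasurableSet F) (hA : MeasurableSet A) :
    ∫⁻ ω in pastEvent X s F, jumpCount X s t A ω ∂P =
      expMeasure 1 A * ∫⁻ ω in pastEvent X s F,
        (∫⁻ r in Ioc s t, ENNReal.ofReal (Real.exp (X r ω))) ∂P := by
  have hA' := hA.diff (measurableSet_singleton 0)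
  have h0 : (0 : ℝ) ∉ A \ {0} := by simp
  have hnull : expMeasure 1 (A \ {0}) = expMeasure 1 A := by
    refine measure_sdiff_null ?_
    have hac : expMeasure 1 ≪ (volume : Measure ℝ) := withDensity_absolutelyContinuous _ _
    exact hac (by simp)
  have hlim := hX.tendsto_lintegral_sum_jumpLaw hst F hA' h0
  simp_rw [← hX.lintegral_sum_indicator_gridDrop hst hF hA' h0] at hlim
  rw [hnull] at hlim
  refine tendsto_nhds_unique ?_ hlim
  refine tendsto_lintegral_of_dominated_convergence' (jumpCount X s t univ)
    (fun n => (hX.aemeasurable_sum_indicator_gridDrop s t n hA').restrict) (fun n => ?_)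
    (hX.lintegral_jumpCount_univ_lt_top hst hF).ne ?_
  · filter_upwards [ae_restrict_of_ae hX.path] with ω hω
    exact hω.sum_indicator_gridDrop_le hst h0 n
  · filter_upwards [ae_restrict_of_ae hX.path] with ω hω
    rw [← jumpCount_diff_zero s t A]
    exact hω.tendsto_sum_indicator_gridDrop hst h0

theorem solvesJumpSDE (hX : IsVoidProcess X P) :
    SolvesJumpSDE X Real.exp (expMeasure 1) P where
  cadlag := by
    filter_upwards [hX.path] with ω hω
    exact hω.cadlag
  equation := by
    filter_upwards [hX.path] with ω hω s t hst
    exact hω.equation hst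
  aemeasurable_jumpCount s t _ hA := hX.aemeasurable_jumpCount s t hA
  finite_intensity := hX.finite_intensity
  intensity _ _ hst _ _ hF hA := hX.intensity hst hF hA

end IsVoidProcess

end BrownianInterlacement

/-! ### From the Poisson points and moustaches to the void process. -/

namespace BrownianInterlacement

/-! ### Configurations of points -/

/-- There are finitely many points in bounded regions of the right half-plane, at least one point
below each positive height there, and none on its boundary. -/
structure IsRegularConfig (c : ℕ → ℝ × ℝ) : Prop where
  finite : ∀ a b, {k | c k ∈ Icc 0 a ×ˢ Iic b}.Finite
  exists_below : ∀ b, 0 < b → ∃ k, 0 ≤ (c k).1 ∧ (c k).2 ≤ b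
  ne_zero : ∀ k, (c k).1 ≠ 0

/-- The `k`-th point is the leftmost point of height at most `b` in the right half-plane. -/
structure IsLeftmost (c : ℕ → ℝ × ℝ) (b : ℝ) (k : ℕ) : Prop where
  nonneg : 0 ≤ (c k).1
  le : (c k).2 ≤ b
  min : ∀ j, 0 ≤ (c j).1 → (c j).2 ≤ b → (c k).1 ≤ (c j).1

lemma IsLeftmost.antitone {c : ℕ → ℝ × ℝ} {b b' : ℝ} {k k' : ℕ} (hk : IsLeftmost c b k)
    (hk' : IsLeftmost c b' k') (h : b ≤ b') : (c k').1 ≤ (c k).1 :=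
  hk'.min k hk.nonneg (hk.le.trans h)

namespace IsRegularConfig

variable {c : ℕ → ℝ × ℝ}

lemma exists_isLeftmost (hc : IsRegularConfig c) {b : ℝ} (hb : 0 < b) : ∃ k, IsLeftmost c b k := by
  obtain ⟨k₀, h0, hk₀⟩ := hc.exists_below b hb
  -- Any one admissible point bounds the search to a finite set.
  obtain ⟨k, hk, hmin⟩ := Set.exists_min_image _ (fun k => (c k).1) (hc.finite (c k₀).1 b)
    ⟨k₀, ⟨h0, le_rfl⟩, hk₀⟩
  refine ⟨k, hk.1.1, hk.2, fun j hj hjb => ?_⟩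
  rcases le_total (c j).1 (c k₀).1 with h | h
  · exact hmin j ⟨⟨hj, h⟩, hjb⟩
  · exact hk.1.2.trans h

lemma pos_of_isLeftmost (hc : IsRegularConfig c) {b : ℝ} {k : ℕ} (hk : IsLeftmost c b k) :
    0 < (c k).1 :=
  lt_of_le_of_ne hk.nonneg (hc.ne_zero k).symm

/-- The abscissa of the leftmost point only depends on which points of a finite set have height
at most `b`. -/
lemma leftmost_congr {A B b b' : ℝ} {k k' : ℕ} (hk : IsLeftmost c b k)
    (hk' : IsLeftmost c b' k') (hA : (c k).1 ≤ A) (hA' : (c k').1 ≤ A) (hB : b ≤ B)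
    (hB' : b' ≤ B)
    (h : ∀ j ∈ {j | c j ∈ Icc 0 A ×ˢ Iic B}, ((c j).2 ≤ b ↔ (c j).2 ≤ b')) :
    (c k).1 = (c k').1 :=
  le_antisymm
    (hk.min k' hk'.nonneg ((h k' ⟨⟨hk'.nonneg, hA'⟩, hk'.le.trans hB'⟩).2 hk'.le))
    (hk'.min k hk.nonneg ((h k ⟨⟨hk.nonneg, hA⟩, hk.le.trans hB⟩).1 hk.le))

end IsRegularConfig

lemma eventually_nhdsGT_le_iff (u r : ℝ) :
    ∀ᶠ q in 𝓝[>] r, (u ≤ 2 * Real.exp q ↔ u ≤ 2 * Real.exp r) := by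
  have hcont : Tendsto (fun q => 2 * Real.exp q) (𝓝[>] r) (𝓝 (2 * Real.exp r)) :=
    ((by fun_prop : Continuous fun q => 2 * Real.exp q).tendsto r).mono_left nhdsWithin_le_nhds
  rcases le_or_gt u (2 * Real.exp r) with h | h
  · filter_upwards [self_mem_nhdsWithin] with q hq
    have := Real.exp_lt_exp.2 (mem_Ioi.1 hq)
    exact iff_of_true (by linarith) h
  · filter_upwards [hcont.eventually (gt_mem_nhds h)] with q hq
    exact iff_of_false (not_le.2 hq) (not_le.2 h)

/-- A point of height exactly `2e^r` is active at time `r` and later but not before: hence a weak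
inequality on the right, giving right-continuity, and a strict one on the left. -/
lemma eventually_nhdsLT_le_iff (u r : ℝ) :
    ∀ᶠ q in 𝓝[<] r, (u ≤ 2 * Real.exp q ↔ u < 2 * Real.exp r) := by
  have hcont : Tendsto (fun q => 2 * Real.exp q) (𝓝[<] r) (𝓝 (2 * Real.exp r)) :=
    ((by fun_prop : Continuous fun q => 2 * Real.exp q).tendsto r).mono_left nhdsWithin_le_nhds
  rcases lt_or_ge u (2 * Real.exp r) with h | h
  · filter_upwards [hcont.eventually (lt_mem_nhds h)] with q hq
    exact iff_of_true hq.le h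
  · filter_upwards [self_mem_nhdsWithin] with q hq
    have := Real.exp_lt_exp.2 (mem_Iio.1 hq)
    exact iff_of_false (not_le.2 (by linarith)) (not_lt.2 h)

/-! ### Almost sure properties of the points -/

variable {Ω : Type*}

lemma pointCount_eq_zero_iff {E : Type*} {X : ℕ → Ω → E} {A : Set E} {ω : Ω} :
    pointCount X A ω = 0 ↔ ∀ k, X k ω ∉ A := by
  simp [pointCount, ENNReal.tsum_eq_zero, indicator_apply_eq_zero]

lemma finite_of_pointCount_ne_top {E : Type*} {X : ℕ → Ω → E} {A : Set E} {ω : Ω}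
    (h : pointCount X A ω ≠ ∞) : {k | X k ω ∈ A}.Finite := by
  have := ENNReal.finite_const_le_of_tsum_ne_top h one_ne_zero
  refine this.subset fun k hk => ?_
  simp only [mem_ofPred_eq] at hk ⊢
  rw [indicator_of_mem hk, Pi.one_apply]

variable [MeasurableSpace Ω] {P : Measure Ω}

namespace IsPoissonPointProcess

variable {E : Type*} [MeasurableSpace E] {X : ℕ → Ω → E} {ν : Measure E}

lemma measure_void (h : IsPoissonPointProcess X ν P) {A : Set E} (hA : MeasurableSet A)
    (hν : ν A ≠ ∞) : P {ω | ∀ k, X k ω ∉ A} = ENNReal.ofReal (Real.exp (-(ν A).toReal)) := by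
  have hs : {ω | ∀ k, X k ω ∉ A} = {ω | pointCount X A ω = 0} := by
    ext ω; simp only [mem_ofPred_eq, pointCount_eq_zero_iff]
  have hm : MeasurableSet {x : ℝ≥0∞ | x = 0} := measurableSet_singleton 0
  have hpre : (Nat.cast : ℕ → ℝ≥0∞) ⁻¹' {x | x = 0} = {0} := by ext n; simp
  rw [hs, (h.hasLaw_count A hA hν).measure_eq (p := fun x => x = 0) hm,
    Measure.map_apply .of_discrete hm, hpre, poissonMeasure_singleton,
    ENNReal.coe_toNNReal_eq_toReal]
  simp

/-- The Poisson law of the count gives no mass to `∞`. -/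
lemma ae_finite (h : IsPoissonPointProcess X ν P) {A : Set E} (hA : MeasurableSet A)
    (hν : ν A ≠ ∞) : ∀ᵐ ω ∂P, {k | X k ω ∈ A}.Finite := by
  have hm : MeasurableSet {x : ℝ≥0∞ | x = ∞} := measurableSet_singleton ∞
  have hpre : (Nat.cast : ℕ → ℝ≥0∞) ⁻¹' {x | x = ∞} = ∅ := by ext n; simp
  have hz : P {ω | pointCount X A ω = ∞} = 0 := by
    rw [(h.hasLaw_count A hA hν).measure_eq (p := fun x => x = ∞) hm,
      Measure.map_apply .of_discrete hm, hpre, measure_empty]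
  have hae : ∀ᵐ ω ∂P, pointCount X A ω ≠ ∞ := by simpa [ae_iff] using hz
  filter_upwards [hae] with ω hω
  exact finite_of_pointCount_ne_top hω

lemma ae_void_of_null [IsProbabilityMeasure P] (h : IsPoissonPointProcess X ν P) {A : Set E}
    (hA : MeasurableSet A) (hν : ν A = 0) : ∀ᵐ ω ∂P, ∀ k, X k ω ∉ A := by
  have hm : MeasurableSet {ω | ∀ k, X k ω ∉ A} := by
    have : {ω | ∀ k, X k ω ∉ A} = ⋂ k, (X k ⁻¹' A)ᶜ := by ext; simp
    rw [this]
    exact MeasurableSet.iInter fun k => ((h.measurable k) hA).compl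
  refine (prob_compl_eq_zero_iff hm).2 ?_
  rw [h.measure_void hA (by simp [hν]), hν]
  simp

end IsPoissonPointProcess

namespace Model

variable (M : Model P)

lemma poisson_pointRate : IsPoissonPointProcess M.point pointRate P := M.poisson

/-- The boxes `[0, n] × (-∞, b]` have rate `n b`, so the probability that all of them are void is at
most `e^{-nb}` for every `n`. -/
lemma ae_exists_below [IsProbabilityMeasure P] {b : ℝ} (hb : 0 < b) :
    ∀ᵐ ω ∂P, ∃ k, 0 ≤ (M.point k ω).1 ∧ (M.point k ω).2 ≤ b := by
  have hle : ∀ n : ℕ, P {ω | ¬∃ k, 0 ≤ (M.point k ω).1 ∧ (M.point k ω).2 ≤ b} ≤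
      ENNReal.ofReal (Real.exp (-(n * b))) := by
    intro n
    have hrate : pointRate (Icc 0 (n : ℝ) ×ˢ Iic b) = ENNReal.ofReal (n * b) := by
      rw [pointRate_Icc_prod, ENNReal.ofReal_mul n.cast_nonneg]
    have hv := M.poisson_pointRate.measure_void (measurableSet_Icc.prod measurableSet_Iic)
      (by rw [hrate]; exact ENNReal.ofReal_ne_top)
    rw [hrate, ENNReal.toReal_ofReal (by positivity)] at hv
    rw [← hv]
    refine measure_mono fun ω hω k hk => ?_
    exact hω ⟨k, hk.1.1, hk.2⟩
  have hlim : Tendsto (fun n : ℕ => ENNReal.ofReal (Real.exp (-(n * b)))) atTop (𝓝 0) := by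
    rw [← ENNReal.ofReal_zero]
    exact ENNReal.tendsto_ofReal (Real.tendsto_exp_neg_atTop_nhds_zero.comp
      (tendsto_natCast_atTop_atTop.atTop_mul_const hb))
  exact le_antisymm (ge_of_tendsto' hlim hle) zero_le

lemma ae_isRegularConfig [IsProbabilityMeasure P] :
    ∀ᵐ ω ∂P, IsRegularConfig fun k => M.point k ω := by
  have hfin : ∀ᵐ ω ∂P, ∀ n : ℕ,
      {k | M.point k ω ∈ Icc 0 (n : ℝ) ×ˢ Iic (n : ℝ)}.Finite := by
    refine ae_all_iff.2 fun n =>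
      M.poisson_pointRate.ae_finite (measurableSet_Icc.prod measurableSet_Iic) ?_
    rw [pointRate_Icc_prod]
    exact ENNReal.mul_ne_top ENNReal.ofReal_ne_top ENNReal.ofReal_ne_top
  have hbelow : ∀ᵐ ω ∂P, ∀ n : ℕ,
      ∃ k, 0 ≤ (M.point k ω).1 ∧ (M.point k ω).2 ≤ 1 / ((n : ℝ) + 1) :=
    ae_all_iff.2 fun n => M.ae_exists_below (by positivity)
  have hzero : ∀ᵐ ω ∂P, ∀ k, M.point k ω ∉ ({0} : Set ℝ) ×ˢ (univ : Set ℝ) := by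
    refine M.poisson_pointRate.ae_void_of_null
      ((measurableSet_singleton 0).prod MeasurableSet.univ) ?_
    rw [pointRate, Measure.prod_prod]
    simp
  filter_upwards [hfin, hbelow, hzero] with ω h1 h2 h3
  refine ⟨fun a b => ?_, fun b hb => ?_, fun k hk => h3 k ⟨hk, trivial⟩⟩
  · obtain ⟨n, hn⟩ := exists_nat_ge (max a b)
    refine (h1 n).subset fun k hk => ?_
    exact ⟨⟨hk.1.1, hk.1.2.trans ((le_max_left a b).trans hn)⟩,
      le_trans hk.2 ((le_max_right a b).trans hn)⟩
  · obtain ⟨n, hn⟩ := exists_nat_one_div_lt hb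
    obtain ⟨k, hk, hk'⟩ := h2 n
    exact ⟨k, hk, hk'.trans hn.le⟩

/-! ### The distance to the interlacement and the leftmost points -/

/-- The points form a regular configuration, and the moustaches start on the unit circle and
stay outside it. -/
structure IsGood (ω : Ω) : Prop where
  regular : IsRegularConfig fun k => M.point k ω
  radius_zero : ∀ k j, (M.moustache k).radius j 0 ω = 1
  one_lt_radius : ∀ k j t, 0 < t → 1 < (M.moustache k).radius j t ω

lemma ae_isGood [IsProbabilityMeasure P] : ∀ᵐ ω ∂P, M.IsGood ω := by
  have h1 : ∀ᵐ ω ∂P, ∀ k j, (M.moustache k).radius j 0 ω = 1 :=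
    ae_all_iff.2 fun k => ae_all_iff.2 fun j => (M.moustache k).radius_zero j
  have h2 : ∀ᵐ ω ∂P, ∀ k j t, 0 < t → 1 < (M.moustache k).radius j t ω :=
    ae_all_iff.2 fun k => ae_all_iff.2 fun j => (M.moustache k).one_lt_radius j
  filter_upwards [M.ae_isRegularConfig, h1, h2] with ω h0 h1 h2
  exact ⟨h0, h1, h2⟩

namespace IsGood

variable {M} {ω : Ω}

lemma norm_arm (r x θ : ℝ) :
    ‖(Real.exp x : ℂ) * ((r : ℂ) * Complex.exp (Complex.I * (θ : ℂ)))‖ = Real.exp x * |r| := by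
  rw [norm_mul, norm_mul, mul_comm Complex.I, Complex.norm_exp_ofReal_mul_I, mul_one,
    Complex.norm_real, Complex.norm_real, Real.norm_eq_abs, Real.norm_eq_abs,
    abs_of_pos (Real.exp_pos x)]

/-- The point of the interlacement nearest to the origin is the start of a moustache. -/
lemma Φ_eq (h : M.IsGood ω) {α : ℝ} {k : ℕ}
    (hk : IsLeftmost (fun k => M.point k ω) (2 * α) k) :
    M.Φ 0 α ω = Real.exp (M.point k ω).1 := by
  have hmem : (Real.exp (M.point k ω).1 : ℂ) * (((M.moustache k).radius 0 0 ω : ℂ) *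
      Complex.exp (Complex.I * ((M.moustache k).arg 0 0 ω : ℂ))) ∈ M.bri α 1 ω :=
    mem_iUnion₂.2 ⟨k, ⟨hk.le, Real.one_le_exp_iff.2 hk.nonneg⟩, _, ⟨0, 0, rfl⟩, rfl⟩
  refine le_antisymm ((Metric.infDist_le_dist_of_mem hmem).trans ?_)
    ((Metric.le_infDist ⟨_, hmem⟩).2 ?_)
  · rw [dist_zero_left, norm_arm, h.radius_zero]; simp
  · intro z hz
    obtain ⟨j, ⟨hj, hj'⟩, _, ⟨i, t, rfl⟩, rfl⟩ := mem_iUnion₂.1 hz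
    have hle := hk.min j (Real.one_le_exp_iff.1 hj') hj
    have hr : 1 ≤ (M.moustache j).radius i t ω := by
      rcases eq_or_ne t 0 with rfl | ht
      · exact (h.radius_zero j i).ge
      · exact (h.one_lt_radius j i t (pos_iff_ne_zero.2 ht)).le
    rw [dist_zero_left, norm_arm, abs_of_pos (by linarith)]
    have := Real.exp_le_exp.2 hle
    nlinarith [Real.exp_pos (M.point j ω).1]

lemma one_lt_Φ (h : M.IsGood ω) {α : ℝ} (hα : 0 < α) : 1 < M.Φ 0 α ω := by
  obtain ⟨k, hk⟩ := h.regular.exists_isLeftmost (b := 2 * α) (by linarith)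
  rw [h.Φ_eq hk]
  exact Real.one_lt_exp_iff.2 (h.regular.pos_of_isLeftmost hk)

lemma Y_eq (h : M.IsGood ω) {β : ℝ} {k : ℕ}
    (hk : IsLeftmost (fun k => M.point k ω) (2 * Real.exp β) k) :
    M.Y β ω = β + Real.log (M.point k ω).1 + Real.log 2 := by
  rw [Y, h.Φ_eq hk, Real.log_exp]

lemma exists_isLeftmost (h : M.IsGood ω) (β : ℝ) :
    ∃ k, IsLeftmost (fun k => M.point k ω) (2 * Real.exp β) k :=
  h.regular.exists_isLeftmost (by positivity)

/-- `Y β > y` means that the leftmost abscissa exceeds `e^{y-β}/2`. The strict inequality is what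
matches the closed box. -/
lemma lt_Y_iff (h : M.IsGood ω) (β y : ℝ) :
    y < M.Y β ω ↔ ∀ k, M.point k ω ∉ voidBox β y := by
  obtain ⟨k, hk⟩ := h.exists_isLeftmost β
  have hpos := h.regular.pos_of_isLeftmost hk
  have hY : y < M.Y β ω ↔ Real.exp (y - β) / 2 < (M.point k ω).1 := by
    rw [h.Y_eq hk, div_lt_iff₀ two_pos, ← Real.lt_log_iff_exp_lt (by positivity),
      Real.log_mul hpos.ne' two_ne_zero]
    constructor <;> intro <;> linarith
  rw [hY]
  constructor
  · rintro hlt j ⟨⟨hj0, hj⟩, hj'⟩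
    exact absurd (hk.min j hj0 hj') (not_le.2 (hj.trans_lt hlt))
  · intro hall
    by_contra hle
    exact hall k ⟨⟨hk.nonneg, not_lt.1 hle⟩, hk.le⟩

lemma forall_lt_Y_iff (h : M.IsGood ω) (L : Finset (ℝ × ℝ)) :
    (∀ p ∈ L, p.2 < M.Y p.1 ω) ↔ ∀ k, M.point k ω ∉ voidRegion L := by
  simp only [h.lt_Y_iff, voidRegion, mem_iUnion, not_exists]
  exact ⟨fun H k p hp => H p hp k, fun H p hp k => H k p hp⟩

lemma antitone (h : M.IsGood ω) : Antitone fun r => M.Y r ω - r := by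
  intro r q hrq
  obtain ⟨k, hk⟩ := h.exists_isLeftmost r
  obtain ⟨j, hj⟩ := h.exists_isLeftmost q
  have hle := hk.antitone hj (by linarith [Real.exp_le_exp.2 hrq])
  have := Real.log_le_log (h.regular.pos_of_isLeftmost hj) hle
  simp only
  rw [h.Y_eq hk, h.Y_eq hj]
  linarith

lemma isDriftJumpPath (h : M.IsGood ω) : IsDriftJumpPath M.Y ω := by
  intro r
  -- At all times in `[r - 1, r + 1]` the leftmost point is no further right than at time `r - 1`,
  -- so only finitely many points matter. On either side of `r`, close enough to it, the set of
  -- active ones among them is constant, and so is `Y q - q`.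
  obtain ⟨k₀, hk₀⟩ := h.exists_isLeftmost (r - 1)
  have hfin := h.regular.finite (M.point k₀ ω).1 (2 * Real.exp (r + 1))
  have hcongr : ∀ q q', q ∈ Icc (r - 1) (r + 1) → q' ∈ Icc (r - 1) (r + 1) →
      (∀ k ∈ {k | M.point k ω ∈ Icc 0 (M.point k₀ ω).1 ×ˢ Iic (2 * Real.exp (r + 1))},
        ((M.point k ω).2 ≤ 2 * Real.exp q ↔ (M.point k ω).2 ≤ 2 * Real.exp q')) →
      M.Y q ω - q = M.Y q' ω - q' := by
    intro q q' hq hq' hiff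
    obtain ⟨k, hk⟩ := h.exists_isLeftmost q
    obtain ⟨k', hk'⟩ := h.exists_isLeftmost q'
    have heq : (M.point k ω).1 = (M.point k' ω).1 :=
      IsRegularConfig.leftmost_congr hk hk'
        (hk₀.antitone hk (by linarith [Real.exp_le_exp.2 hq.1]))
        (hk₀.antitone hk' (by linarith [Real.exp_le_exp.2 hq'.1]))
        (by linarith [Real.exp_le_exp.2 hq.2]) (by linarith [Real.exp_le_exp.2 hq'.2]) hiff
    rw [h.Y_eq hk, h.Y_eq hk', heq]
    ring
  have hright : ∀ᶠ q in 𝓝[>] r, q ∈ Icc (r - 1) (r + 1) :=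
    nhdsWithin_le_nhds (Icc_mem_nhds (by linarith) (by linarith))
  have hleft : ∀ᶠ q in 𝓝[<] r, q ∈ Icc (r - 1) (r + 1) :=
    nhdsWithin_le_nhds (Icc_mem_nhds (by linarith) (by linarith))
  constructor
  · filter_upwards [hright, (eventually_all_finite hfin).2 fun k _ =>
      eventually_nhdsGT_le_iff (M.point k ω).2 r] with q hq hiff
    exact hcongr q r hq ⟨by linarith, by linarith⟩ hiff
  · have hev := hleft.and ((eventually_all_finite hfin).2 fun k _ =>
      eventually_nhdsLT_le_iff (M.point k ω).2 r)
    obtain ⟨q₀, hq₀, hiff₀⟩ := hev.exists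
    refine ⟨M.Y q₀ ω - q₀, ?_⟩
    filter_upwards [hev] with q hq
    exact hcongr q q₀ hq.1 hq₀ fun k hk => (hq.2 k hk).trans (hiff₀ k hk).symm

end IsGood

variable [IsProbabilityMeasure P]

lemma aemeasurable_Y_path : AEMeasurable (fun ω β => M.Y β ω) P := by
  classical
  -- A single null set has to serve for uncountably many times. Off it, each event `Y β > y` is a
  -- countable intersection of conditions on the points.
  obtain ⟨N, hsub, hN, hN0⟩ := exists_measurable_superset_of_null (ae_iff.1 M.ae_isGood)
  have hgood : ∀ ω ∉ N, M.IsGood ω := fun ω hω => by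
    by_contra hbad
    exact hω (hsub hbad)
  refine ⟨fun ω β => if ω ∈ N then 0 else M.Y β ω, ?_, ?_⟩
  · refine measurable_pi_lambda _ fun β => measurable_of_Ioi fun y => ?_
    have hset : (fun ω => if ω ∈ N then 0 else M.Y β ω) ⁻¹' Ioi y =
        (N ∩ {_ω | y < 0}) ∪ (Nᶜ ∩ ⋂ k, (M.point k ⁻¹' voidBox β y)ᶜ) := by
      ext ω
      by_cases hω : ω ∈ N
      · simp [hω]
      · simp [hω, (hgood ω hω).lt_Y_iff β y]
    rw [hset]
    exact (hN.inter (MeasurableSet.const _)).union (hN.compl.inter (MeasurableSet.iInter fun k =>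
      (M.poisson.measurable k (measurableSet_voidBox β y)).compl))
  · filter_upwards [measure_eq_zero_iff_ae_notMem.1 hN0] with ω hω
    simp [hω]

theorem isVoidProcess_Y : IsVoidProcess M.Y P where
  aemeasurable_path := M.aemeasurable_Y_path
  void L := by
    rw [← M.poisson_pointRate.measure_void (measurableSet_voidRegion L)
      (pointRate_voidRegion_ne_top L)]
    refine measure_congr ?_
    filter_upwards [M.ae_isGood] with ω hω
    exact propext (hω.forall_lt_Y_iff L)
  path := M.ae_isGood.mono fun _ hω => hω.isDriftJumpPath
  antitone := M.ae_isGood.mono fun _ hω => hω.antitone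

end Model

end BrownianInterlacement

end

open BrownianInterlacement in
theorem theorem2 {Ω : Type*} [MeasurableSpace Ω] (P : Measure Ω) [IsProbabilityMeasure P]
    (M : Model P) :
    -- `Y` is well defined: `Φ₀(α) > 1` for all levels
    (∀ᵐ ω ∂P, ∀ α, 0 < α → 1 < M.Φ 0 α ω) ∧
    IsStationary M.Y P ∧
    (∃ κ : ℝ≥0 → Kernel ℝ ℝ, IsMarkovSemigroup κ ∧ IsMarkovProcess M.Y κ P ∧
      -- the generator, on all `C¹` functions for which its formula makes sense
      (∀ f : ℝ → ℝ, ContDiff ℝ 1 f →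
        (∀ y, IntegrableOn (fun u => f (y - u) * Real.exp (-u)) (Ioi 0)) →
        ∀ y, (∀ t, Integrable f (κ t y)) ∧
          Tendsto (fun t : ℝ≥0 => ((∫ z, f z ∂(κ t y)) - f y) / (t : ℝ)) (𝓝[>] 0)
            (𝓝 (generator f y))) ∧
      -- the unique invariant probability measure
      (∀ ν : Measure ℝ, IsProbabilityMeasure ν →
        ((∀ t, Kernel.Invariant (κ t) ν) ↔ ν = negGumbel))) ∧
    -- unit drift, jump rate `e^y`, downward jumps of law `Exp(1)`
    SolvesJumpSDE M.Y Real.exp (expMeasure 1) P ∧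
    (∀ β, HasLaw (M.Y β) negGumbel P) ∧
    -- `negGumbel` is the law of the negative of a standard Gumbel variable
    (∀ x : ℝ, (negGumbel.map fun y => -y) (Iic x) =
      ENNReal.ofReal (Real.exp (-Real.exp (-x)))) := by
  have hY := M.isVoidProcess_Y
  refine ⟨M.ae_isGood.mono fun ω hω α hα => hω.one_lt_Φ hα, hY.isStationary,
    ⟨transitionKernel, isMarkovSemigroup_transitionKernel, hY.isMarkovProcess, ?_, ?_⟩,
    hY.solvesJumpSDE, hY.hasLaw, negGumbel_map_neg_Iic⟩
  · exact fun f hf hfi y =>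
      ⟨fun t => integrable_transitionLaw hf.continuous hfi t y, tendsto_generator hf hfi y⟩
  · intro ν hν
    refine ⟨fun h => eq_negGumbel_of_invariant ν h, ?_⟩
    rintro rfl
    exact invariant_negGumbel
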